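/- For $N\ge 1$ let $P_N(z)=\sum_{n=0}^N a_n\sqrt{\binom{N}{n}}\,z^n$ be a random elliptic polynomial, where $a_0,\dots,a_N$ are independent standard complex Gaussian variables (density $\pi^{-1}e^{-|z|^2}$ on $\mathbb C$). Let $X_N=\{x_1,\dots,x_N\}$ be the $N$ points of the unit sphere $\mathbb S^2\subset\mathbb R^3$ whose images under stereographic projection from the north pole onto the equatorial plane $\mathbb C$ are the zeros of $P_N$ (listed with multiplicity; almost surely there are $N$ of them). For real $t$ let $$G(t,X_N)=\#\{(i,j): i<j,\ |x_i-x_j|\le t\},$$ where $|\cdot|$ is the Euclidean norm of $\mathbb R^3$. Then $G(t,X_N)$ is integrable for every $t$, and: 1. for every $N\ge1$ and $0<t<2$, $$\mathbb E[G(t,X_N)]=\frac{t^2N^2}{8}-\frac N2+\frac{t^2N^2}{8(4-t^2)\left(\left(\frac{4}{4-t^2}\right)^N-1\right)}\left[8-t^2-t^2N-\frac{t^2N}{\left(\frac{4}{4-t^2}\right)^N-1}\right];$$ 2. if $t_N\ge 0$ and $t_N=o(N^{-1/2})$ as $N\to\infty$, then $$\mathbb E[G(t_N,X_N)]=\frac{N^3t_N^4}{128}\,(1+o(1))\qquad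 (N\to\infty);$$ 3. for every $N\ge1$ and every real $t\le 2$, $$\mathbb E[G(t,X_N)]\le\frac{N^3t^4}{128}.$$ -/

import Mathlib

open MeasureTheory ProbabilityTheory Filter Asymptotics

noncomputable section

/-- The standard complex Gaussian law: density `exp (-|z|^2) / π` with respect to Lebesgue measure
on the complex plane. -/
def stdComplexGaussian : Measure ℂ :=
  volume.withDensity fun z => ENNReal.ofReal (Real.exp (-‖z‖ ^ 2) / Real.pi)

/-- The elliptic polynomial of degree `N` with coefficients `a 0, …, a N`,
namely the sum of `a n * √(N choose n) * z ^ n` over `0 ≤ n ≤ N`. -/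
def ellipticPoly (N : ℕ) (a : Fin (N + 1) → ℂ) : Polynomial ℂ :=
  ∑ n : Fin (N + 1),
    Polynomial.monomial (n : ℕ) (a n * ((Real.sqrt (N.choose (n : ℕ) : ℝ) : ℝ) : ℂ))

/-- The unit sphere in Euclidean three-space; its distance is the chordal distance. -/
abbrev UnitSphere : Type := Metric.sphere (0 : EuclideanSpace ℝ (Fin 3)) 1

/-- The point of the unit sphere whose stereographic projection from the north pole `(0, 0, 1)` to
the equatorial plane is `z`. -/
def stereoInv (z : ℂ) : UnitSphere :=
  ⟨!₂[2 * z.re / (1 + ‖z‖ ^ 2), 2 * z.im / (1 + ‖z‖ ^ 2), (‖z‖ ^ 2 - 1) / (1 + ‖z‖ ^ 2)], by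
    have h : (1 + ‖z‖ ^ 2 : ℝ) ≠ 0 := by positivity
    have hz : ‖z‖ ^ 2 = z.re ^ 2 + z.im ^ 2 := by
      rw [Complex.sq_norm, Complex.normSq_apply]; ring
    rw [mem_sphere_zero_iff_norm, EuclideanSpace.norm_eq, Real.sqrt_eq_one]
    simp only [Fin.sum_univ_three, Real.norm_eq_abs, sq_abs]
    simp only [Matrix.cons_val]
    field_simp
    rw [hz]
    ring⟩

/-- `pairCount t x` is the number of pairs `i < j` such that the points `x i` and `x j` are at
chordal distance at most `t`. -/
def pairCount {N : ℕ} (t : ℝ) (x : Fin N → UnitSphere) : ℕ :=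
  Nat.card {p : Fin N × Fin N // p.1 < p.2 ∧ dist (x p.1) (x p.2) ≤ t}

end

/-!
The count is computed through the Palm measure at one zero. Let `P` have degree `N` and let `D` be
the number of ordered pairs of roots, with multiplicity and including the diagonal, at chordal
distance at most `t`; then `D = N + 2 * pairCount` for `t ≥ 0`.

*From roots to an integral.* With all coefficients but the constant one fixed, the roots of `P` are
the preimages of the constant coefficient under a polynomial `h`. The area formula
`lintegral_sum_roots_sub_C` turns the expectation of a sum over roots into an integral over the
position `z` of a root and over the hyperplane of polynomials vanishing at `z`.

*Rotation invariance.* The substitution `(w - z) / (1 + conj z * w)` acts on coefficients by a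
unitary matrix `rotationMatrix`, because it preserves the kernel `(1 + w * conj w') ^ N`. It maps
the hyperplane at `0` to the one at `z`, and the Jacobian between graph coordinates is a
complementary minor of a unitary matrix (`lintegral_gaussianVector_hyperplane`). As chordal distances
are preserved, the integral over `z` factors out and `lintegral_closePairSum` gives
`E D = N * E[‖b 0‖ ^ 2 * #{roots of X * Q_b within t of 0}]`, where `b 0` is the coefficient of `X`.

*The second root.* A second use of the area formula, now solving `Q_b(w) = 0` for `b 0`, gives the
density of further zeros at `w` as the moment `E[‖k‖ ^ 2 * ‖k'‖ ^ 2 * exp (-‖k‖ ^ 2)]` of two linear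
forms in a Gaussian vector (`lintegral_two_linear_forms`). In `u = ‖w‖ ^ 2` this density is the
derivative of `u * σ' * (σ - 1) / σ ^ 2`, where `σ = ((1 + u) ^ N - 1) / (N * u)`; the disc
`dist ≤ t` is `u ≤ t ^ 2 / (4 - t ^ 2)`. This is the exact formula.

*Bounds.* With `q = 1 + u` and `Q = q ^ N`, the upper bound `N ^ 3 * t ^ 4 / 128` is
`4 * X * Y ≤ (X + Y) ^ 2 = (N * u * (Q - q)) ^ 2` for `X = N * u * Q - q * (Q - 1)` and
`Y = q * (Q - 1 - N * u)`. The elementary lower bound `le_palmCount` is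
asymptotically equal to it when `N * u → 0`.
-/

open scoped ENNReal

/-! ### Complex Gaussian vectors -/

/-- Polar coordinates in `ℂ`, with the squared radius as variable. -/
theorem lintegral_comp_norm_sq (f : ℝ → ℝ≥0∞) (hf : Measurable f) :
    ∫⁻ z : ℂ, f (‖z‖ ^ 2) = ENNReal.ofReal Real.pi * ∫⁻ u in Set.Ioi 0, f u := by
  rw [← Complex.lintegral_comp_polarCoord_symm]
  have hsub : ∫⁻ u in Set.Ioi (0 : ℝ), f u
      = ∫⁻ r in Set.Ioi (0 : ℝ), ENNReal.ofReal (2 * r) * f (r ^ 2) := by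
    have himg : (fun r : ℝ => r ^ 2) '' Set.Ioi 0 = Set.Ioi 0 := by
      ext u
      constructor
      · rintro ⟨r, hr, rfl⟩
        exact pow_pos (Set.mem_Ioi.1 hr) 2
      · intro hu
        exact ⟨Real.sqrt u, Real.sqrt_pos.2 hu, Real.sq_sqrt (le_of_lt hu)⟩
    have h := lintegral_image_eq_lintegral_abs_deriv_mul (s := Set.Ioi (0 : ℝ))
      (f := fun r : ℝ => r ^ 2) (f' := fun r => 2 * r) measurableSet_Ioi
      (fun r _ => by simpa using (hasDerivAt_pow 2 r).hasDerivWithinAt)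
      (fun a ha b hb hab => by
        exact (sq_eq_sq₀ (le_of_lt ha) (le_of_lt hb)).1 hab) f
    rw [himg] at h
    rw [h]
    refine setLIntegral_congr_fun measurableSet_Ioi fun r hr => ?_
    have : (0 : ℝ) < r := hr
    rw [abs_of_pos (by positivity)]
  have htarget : polarCoord.target = Set.Ioi (0 : ℝ) ×ˢ Set.Ioo (-Real.pi) Real.pi := rfl
  rw [htarget, Measure.volume_eq_prod, ← Measure.prod_restrict,
    lintegral_prod _ (by simp only [Complex.norm_polarCoord_symm]; fun_prop)]
  simp only [Complex.norm_polarCoord_symm, sq_abs, lintegral_const, Measure.restrict_apply_univ,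
    Real.volume_Ioo, smul_eq_mul]
  rw [lintegral_mul_const _ (by fun_prop), hsub, mul_comm, show Real.pi - -Real.pi = Real.pi * 2 by
    ring, ENNReal.ofReal_mul Real.pi_pos.le, mul_assoc, ← lintegral_const_mul _ (by fun_prop)]
  congr 1
  refine setLIntegral_congr_fun measurableSet_Ioi fun r hr => ?_
  rw [ENNReal.ofReal_mul (by norm_num), mul_assoc]

theorem lintegral_pow_mul_exp_neg_mul (m : ℕ) {c : ℝ} (hc : 0 < c) :
    ∫⁻ u in Set.Ioi (0 : ℝ), ENNReal.ofReal (u ^ m * Real.exp (-(c * u)))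
      = ENNReal.ofReal (m.factorial / c ^ (m + 1)) := by
  have h := Real.integral_rpow_mul_exp_neg_mul_Ioi (a := m + 1) (r := c) (by positivity) hc
  have h' : ∫ u in Set.Ioi (0 : ℝ), u ^ m * Real.exp (-(c * u)) = m.factorial / c ^ (m + 1) := by
    rw [Real.Gamma_nat_eq_factorial] at h
    rw [show ((m.factorial : ℝ) / c ^ (m + 1)) = (1 / c) ^ ((m : ℝ) + 1) * m.factorial by
      rw [show ((m : ℝ) + 1) = ((m + 1 : ℕ) : ℝ) by push_cast; ring, Real.rpow_natCast]
      rw [one_div, inv_pow]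
      field_simp, ← h]
    refine setIntegral_congr_fun measurableSet_Ioi fun u hu => ?_
    simp
  have hpos : (0 : ℝ) < m.factorial / c ^ (m + 1) := by positivity
  rw [← h', ofReal_integral_eq_lintegral_ofReal]
  · by_contra hn
    rw [integral_undef hn] at h'
    linarith
  · refine (ae_restrict_iff' measurableSet_Ioi).2 (ae_of_all _ fun u hu => ?_)
    have : (0 : ℝ) < u := hu
    positivity

theorem lintegral_stdComplexGaussian (f : ℂ → ℝ≥0∞) (hf : Measurable f) :
    ∫⁻ z, f z ∂stdComplexGaussian
      = ∫⁻ z, ENNReal.ofReal (Real.exp (-‖z‖ ^ 2) / Real.pi) * f z := by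
  rw [stdComplexGaussian, lintegral_withDensity_eq_lintegral_mul _ (by fun_prop) hf]
  rfl

/-- Exponentially tilted moments: `‖z‖ ^ 2` is a standard exponential variable. -/
theorem lintegral_norm_pow_mul_exp_stdComplexGaussian (m : ℕ) {c : ℝ} (hc : 0 ≤ c) :
    ∫⁻ z, ENNReal.ofReal ((‖z‖ ^ 2) ^ m * Real.exp (-(c * ‖z‖ ^ 2))) ∂stdComplexGaussian
      = ENNReal.ofReal (m.factorial / (1 + c) ^ (m + 1)) := by
  rw [lintegral_stdComplexGaussian _ (by fun_prop)]
  have : ∀ z : ℂ, ENNReal.ofReal (Real.exp (-‖z‖ ^ 2) / Real.pi) *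
      ENNReal.ofReal ((‖z‖ ^ 2) ^ m * Real.exp (-(c * ‖z‖ ^ 2))) =
      (fun u : ℝ => ENNReal.ofReal (u ^ m * Real.exp (-((1 + c) * u))) *
        ENNReal.ofReal (1 / Real.pi)) (‖z‖ ^ 2) := by
    intro z
    have hp := Real.pi_pos
    simp only
    rw [← ENNReal.ofReal_mul (by positivity), ← ENNReal.ofReal_mul (by positivity)]
    congr 1
    rw [show -((1 + c) * ‖z‖ ^ 2) = -‖z‖ ^ 2 + -(c * ‖z‖ ^ 2) by ring, Real.exp_add]
    ring
  simp_rw [this]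
  rw [lintegral_comp_norm_sq (fun u : ℝ => ENNReal.ofReal (u ^ m * Real.exp (-((1 + c) * u))) *
        ENNReal.ofReal (1 / Real.pi)) (by fun_prop),
    lintegral_mul_const _ (by fun_prop), lintegral_pow_mul_exp_neg_mul m (by positivity),
    mul_left_comm, ← ENNReal.ofReal_mul Real.pi_pos.le, mul_one_div_cancel Real.pi_ne_zero]
  simp

instance : IsProbabilityMeasure stdComplexGaussian := by
  refine ⟨?_⟩
  have h := lintegral_norm_pow_mul_exp_stdComplexGaussian 0 le_rfl
  simpa using h

theorem lintegral_norm_sq_stdComplexGaussian :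
    ∫⁻ z, ENNReal.ofReal (‖z‖ ^ 2) ∂stdComplexGaussian = 1 := by
  simpa using lintegral_norm_pow_mul_exp_stdComplexGaussian 1 le_rfl

theorem lintegral_comp_neg_stdComplexGaussian (f : ℂ → ℝ≥0∞) (hf : Measurable f) :
    ∫⁻ z, f (-z) ∂stdComplexGaussian = ∫⁻ z, f z ∂stdComplexGaussian := by
  rw [lintegral_stdComplexGaussian _ (by fun_prop), lintegral_stdComplexGaussian _ hf,
    ← lintegral_neg_eq_self]
  simp

/-- The mean square of an affine function of a Gaussian; the cross term is removed by symmetry, which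
avoids any integrability question. -/
theorem lintegral_norm_add_mul_sq (x β : ℂ) :
    ∫⁻ c, ENNReal.ofReal (‖x + β * c‖ ^ 2) ∂stdComplexGaussian
      = ENNReal.ofReal (‖x‖ ^ 2 + ‖β‖ ^ 2) := by
  have hsym : ∫⁻ c, ENNReal.ofReal (‖x - β * c‖ ^ 2) ∂stdComplexGaussian =
      ∫⁻ c, ENNReal.ofReal (‖x + β * c‖ ^ 2) ∂stdComplexGaussian := by
    rw [← lintegral_comp_neg_stdComplexGaussian _ (by fun_prop)]
    simp [sub_eq_add_neg]
  have hsum : 2 * ∫⁻ c, ENNReal.ofReal (‖x + β * c‖ ^ 2) ∂stdComplexGaussian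
      = 2 * ENNReal.ofReal (‖x‖ ^ 2 + ‖β‖ ^ 2) := by
    rw [two_mul]
    nth_rewrite 2 [← hsym]
    rw [← lintegral_add_left (by fun_prop)]
    have : ∀ c : ℂ, ENNReal.ofReal (‖x + β * c‖ ^ 2) + ENNReal.ofReal (‖x - β * c‖ ^ 2)
        = ENNReal.ofReal (2 * ‖x‖ ^ 2) + ENNReal.ofReal (2 * ‖β‖ ^ 2) *
          ENNReal.ofReal (‖c‖ ^ 2) := by
      intro c
      rw [← ENNReal.ofReal_add (by positivity) (by positivity),
        ← ENNReal.ofReal_mul (by positivity), ← ENNReal.ofReal_add (by positivity) (by positivity)]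
      congr 1
      have := parallelogram_law_with_norm ℝ x (β * c)
      rw [norm_mul] at this
      linarith
    simp_rw [this]
    rw [lintegral_add_left (by fun_prop), lintegral_const_mul _ (by fun_prop),
      lintegral_norm_sq_stdComplexGaussian]
    simp only [lintegral_const, measure_univ, mul_one]
    rw [← ENNReal.ofReal_add (by positivity) (by positivity), ← mul_add,
      ENNReal.ofReal_mul (by norm_num)]
    simp
  exact (ENNReal.mul_right_inj (by norm_num) (by norm_num)).1 hsum

/-- The law of a vector of `n` independent standard complex Gaussian variables. -/
noncomputable abbrev gaussianVector (n : ℕ) : Measure (Fin n → ℂ) :=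
  Measure.pi fun _ => stdComplexGaussian

theorem measurable_finCons {n : ℕ} :
    Measurable fun p : ℂ × (Fin n → ℂ) => (Fin.cons p.1 p.2 : Fin (n + 1) → ℂ) := by
  refine measurable_pi_iff.2 fun i => ?_
  refine Fin.cases ?_ (fun j => ?_) i
  · simpa using measurable_fst
  · simpa [Function.comp_def] using (measurable_pi_apply j).comp (measurable_snd (α := ℂ))

theorem lintegral_pi_finCons {n : ℕ} (μ : Measure ℂ) [SigmaFinite μ]
    (f : (Fin (n + 1) → ℂ) → ℝ≥0∞) (hf : Measurable f) :
    ∫⁻ x, f x ∂(Measure.pi fun _ => μ)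
      = ∫⁻ y, ∫⁻ c, f (Fin.cons c y) ∂μ ∂(Measure.pi fun _ : Fin n => μ) := by
  have h := (measurePreserving_piFinSuccAbove (fun _ : Fin (n + 1) => μ) 0).symm
  rw [← h.lintegral_comp_emb (MeasurableEquiv.measurableEmbedding _),
    lintegral_prod_symm]
  · simp [MeasurableEquiv.piFinSuccAbove_symm_apply, Fin.insertNthEquiv]
  · exact (hf.comp (MeasurableEquiv.measurable _)).aemeasurable

/-- The density of a Gaussian vector. -/
theorem lintegral_gaussianVector {n : ℕ} (f : (Fin n → ℂ) → ℝ≥0∞) (hf : Measurable f) :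
    ∫⁻ x, f x ∂(gaussianVector n)
      = ∫⁻ x, ENNReal.ofReal (Real.exp (-∑ i, ‖x i‖ ^ 2) / Real.pi ^ n) * f x := by
  induction n with
  | zero =>
    rw [volume_pi, gaussianVector, Measure.pi_of_empty _ (0 : Fin 0 → ℂ),
      Measure.pi_of_empty _ (0 : Fin 0 → ℂ)]
    simp
  | succ n ih =>
    have hm := measurable_finCons (n := n)
    rw [lintegral_pi_finCons _ _ hf, volume_pi, lintegral_pi_finCons _ _ (by fun_prop),
      ih _ (by
        refine Measurable.lintegral_prod_left' (f := fun p : ℂ × (Fin n → ℂ) =>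
          f (Fin.cons p.1 p.2)) (hf.comp hm)), ← volume_pi]
    refine lintegral_congr fun y => ?_
    have hfy : Measurable fun c : ℂ => f (Fin.cons c y) :=
      (hf.comp hm).comp (measurable_id.prodMk measurable_const)
    rw [lintegral_stdComplexGaussian _ hfy, ← lintegral_const_mul _ (by fun_prop)]
    refine lintegral_congr fun c => ?_
    rw [← mul_assoc, ← ENNReal.ofReal_mul (by positivity)]
    congr 2
    rw [Fin.sum_univ_succ]
    simp only [Fin.cons_zero, Fin.cons_succ]
    rw [neg_add, Real.exp_add, pow_succ]
    ring

/-- Complex-linear change of variables: the real Jacobian is the squared modulus of the determinant. -/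
theorem lintegral_comp_mulVec_mul {n : ℕ} (T : Matrix (Fin n) (Fin n) ℂ) (hT : T.det ≠ 0)
    (f : (Fin n → ℂ) → ℝ≥0∞) (hf : Measurable f) :
    ENNReal.ofReal (‖T.det‖ ^ 2) * ∫⁻ x, f (T.mulVec x) = ∫⁻ x, f x := by
  set L : (Fin n → ℂ) →ₗ[ℝ] (Fin n → ℂ) := (Matrix.toLin' T).restrictScalars ℝ with hL
  have hdet : LinearMap.det L = ‖T.det‖ ^ 2 := by
    rw [hL, LinearMap.det_restrictScalars, LinearMap.det_toLin', Algebra.norm_complex_eq]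
    simp [Complex.normSq_eq_norm_sq]
  have hne : LinearMap.det L ≠ 0 := by
    rw [hdet]
    exact pow_ne_zero _ (norm_ne_zero_iff.2 hT)
  have hmap := Measure.map_linearMap_addHaar_eq_smul_addHaar
    (volume : Measure (Fin n → ℂ)) hne
  have hLm : Measurable L := (LinearMap.continuous_of_finiteDimensional L).measurable
  have h1 : ∫⁻ x, f (T.mulVec x) = ∫⁻ x, f x ∂(Measure.map L volume) := by
    rw [lintegral_map hf hLm]
    rfl
  rw [h1, hmap, lintegral_smul_measure, hdet, smul_eq_mul, ← mul_assoc,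
    ← ENNReal.ofReal_mul (by positivity), abs_of_nonneg (by positivity), mul_inv_cancel₀ (by
      rwa [hdet] at hne), ENNReal.ofReal_one, one_mul]

theorem sum_norm_sq_mulVec {n : ℕ} {U : Matrix (Fin n) (Fin n) ℂ} (hU : U.conjTranspose * U = 1)
    (x : Fin n → ℂ) : ∑ i, ‖U.mulVec x i‖ ^ 2 = ∑ i, ‖x i‖ ^ 2 := by
  have key : ∀ y : Fin n → ℂ, ((∑ i, ‖y i‖ ^ 2 : ℝ) : ℂ) = dotProduct (star y) y := by
    intro y
    simp only [dotProduct, Pi.star_apply, RCLike.star_def]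
    push_cast
    refine Finset.sum_congr rfl fun i _ => ?_
    rw [mul_comm, Complex.mul_conj, Complex.normSq_eq_norm_sq]
    push_cast
    rfl
  have : ((∑ i, ‖U.mulVec x i‖ ^ 2 : ℝ) : ℂ) = ((∑ i, ‖x i‖ ^ 2 : ℝ) : ℂ) := by
    rw [key, key, Matrix.star_mulVec, ← Matrix.dotProduct_mulVec, Matrix.mulVec_mulVec, hU,
      Matrix.one_mulVec]
  exact_mod_cast this

theorem norm_det_of_conjTranspose_mul_self {n : ℕ} {U : Matrix (Fin n) (Fin n) ℂ}
    (hU : U.conjTranspose * U = 1) : ‖U.det‖ = 1 := by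
  have h := congrArg Matrix.det hU
  rw [Matrix.det_mul, Matrix.det_conjTranspose, Matrix.det_one] at h
  have h2 := congrArg norm h
  rw [norm_mul, norm_star, norm_one] at h2
  nlinarith [norm_nonneg U.det]

theorem lintegral_gaussianVector_comp_mulVec {n : ℕ} {U : Matrix (Fin n) (Fin n) ℂ}
    (hU : U.conjTranspose * U = 1) (f : (Fin n → ℂ) → ℝ≥0∞) (hf : Measurable f) :
    ∫⁻ x, f (U.mulVec x) ∂(gaussianVector n) = ∫⁻ x, f x ∂(gaussianVector n) := by
  have hdet := norm_det_of_conjTranspose_mul_self hU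
  have hmul : Measurable U.mulVec := (Matrix.mulVecLin U).continuous_of_finiteDimensional.measurable
  rw [lintegral_gaussianVector (fun x => f (U.mulVec x)) (hf.comp hmul), lintegral_gaussianVector _ hf]
  have h := lintegral_comp_mulVec_mul U (by rw [← norm_ne_zero_iff, hdet]; norm_num)
    (fun x => ENNReal.ofReal (Real.exp (-∑ i, ‖x i‖ ^ 2) / Real.pi ^ n) * f x) (by fun_prop)
  simpa [sum_norm_sq_mulVec hU, hdet] using h

/-- Gaussian integration over a hyperplane, in graph coordinates: `h` expresses coordinate `0`
through the others on the image of `{b | b 0 = 0}` under a unitary `U`. The Jacobian of the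
parametrization by `b` is a complementary minor of `U`, whose modulus is `‖U 0 0‖`. -/
theorem lintegral_gaussianVector_hyperplane {n : ℕ} {U : Matrix (Fin (n + 1)) (Fin (n + 1)) ℂ}
    (hU : U.conjTranspose * U = 1) (hU0 : U 0 0 ≠ 0) (h : (Fin n → ℂ) → ℂ) (hh : Measurable h)
    (hUh : ∀ b : Fin n → ℂ, U.mulVec (Fin.cons 0 b) 0 =
      h fun i => U.mulVec (Fin.cons 0 b) i.succ)
    (G : (Fin (n + 1) → ℂ) → ℝ≥0∞) (hG : Measurable G) :
    ∫⁻ y, ENNReal.ofReal (Real.exp (-‖h y‖ ^ 2)) * G (Fin.cons (h y) y) ∂(gaussianVector n)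
      = ENNReal.ofReal (‖U 0 0‖ ^ 2) *
        ∫⁻ b, G (U.mulVec (Fin.cons 0 b)) ∂(gaussianVector n) := by
  set T : Matrix (Fin n) (Fin n) ℂ := U.submatrix Fin.succ Fin.succ with hTdef
  have hT : ∀ b : Fin n → ℂ, T.mulVec b = fun i => U.mulVec (Fin.cons 0 b) i.succ := by
    intro b
    funext i
    simp [T, Matrix.mulVec, dotProduct, Fin.sum_univ_succ]
  have hdetU := norm_det_of_conjTranspose_mul_self hU
  -- Since `adjugate U = det U • Uᴴ`, the complementary minor is `det U * conj (U 0 0)`.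
  have hdet : ‖T.det‖ = ‖U 0 0‖ := by
    have h1 : U.adjugate 0 0 = T.det := by
      rw [Matrix.adjugate_fin_succ_eq_det_submatrix]
      simp [T]
    have h2 : U.adjugate = U.det • U.conjTranspose := by
      have : U.adjugate * U = U.det • (1 : Matrix _ _ ℂ) := Matrix.adjugate_mul U
      have hU' : U * U.conjTranspose = 1 := mul_eq_one_comm.1 hU
      calc U.adjugate = U.adjugate * (U * U.conjTranspose) := by rw [hU', mul_one]
        _ = _ := by rw [← mul_assoc, this]; simp
    rw [← h1, h2]
    simp [hdetU]
  have hcons : Measurable fun y : Fin n → ℂ => (Fin.cons (h y) y : Fin (n + 1) → ℂ) :=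
    measurable_finCons.comp (hh.prodMk measurable_id)
  have hUm : Measurable fun b : Fin n → ℂ => U.mulVec (Fin.cons 0 b) :=
    (Matrix.mulVecLin U).continuous_of_finiteDimensional.measurable.comp
      (measurable_finCons.comp (measurable_const.prodMk measurable_id))
  rw [lintegral_gaussianVector _ (by fun_prop), lintegral_gaussianVector (fun b => G (U.mulVec (Fin.cons 0 b))) (hG.comp hUm),
    ← lintegral_comp_mulVec_mul T (by rw [← norm_ne_zero_iff, hdet]; simpa) _ (by fun_prop), hdet]
  congr 1
  refine lintegral_congr fun b => ?_
  have hx : (Fin.cons (h (T.mulVec b)) (T.mulVec b) : Fin (n + 1) → ℂ)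
      = U.mulVec (Fin.cons 0 b) := by
    funext i
    refine Fin.cases ?_ (fun j => ?_) i
    · rw [Fin.cons_zero, hT, hUh]
    · rw [Fin.cons_succ, hT]
  rw [hx, ← mul_assoc, ← ENNReal.ofReal_mul (by positivity)]
  congr 2
  rw [div_mul_eq_mul_div, ← Real.exp_add]
  congr 2
  have hs := sum_norm_sq_mulVec hU (Fin.cons 0 b)
  rw [← hx, Fin.sum_univ_succ, Fin.sum_univ_succ] at hs
  simp at hs
  linarith

/-! ### The area formula for complex polynomials -/

open Polynomial in
theorem finite_eval_critical_points {h : Polynomial ℂ} (hd : h.derivative ≠ 0) :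
    {c : ℂ | ∃ z, h.derivative.eval z = 0 ∧ h.eval z = c}.Finite := by
  have : {c : ℂ | ∃ z, h.derivative.eval z = 0 ∧ h.eval z = c}
      ⊆ (fun z => h.eval z) '' (h.derivative.rootSet ℂ) := by
    rintro c ⟨z, hz, rfl⟩
    exact ⟨z, by rw [mem_rootSet]; exact ⟨hd, by simpa using hz⟩, rfl⟩
  exact ((rootSet_finite _ _).image _).subset this

open Polynomial in
/-- Away from the zeros of its derivative, a polynomial is injective on each member of a countable
measurable partition. -/
theorem exists_partition_injOn (h : Polynomial ℂ) :
    ∃ S : ℕ → Set ℂ, (∀ k, MeasurableSet (S k)) ∧ Pairwise (Function.onFun Disjoint S) ∧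
      (⋃ k, S k) = {z | h.derivative.eval z ≠ 0} ∧ ∀ k, Set.InjOn (fun z => h.eval z) (S k) := by
  set R : Set ℂ := {z | h.derivative.eval z ≠ 0} with hR
  have hRo : IsOpen R := isOpen_ne_fun h.derivative.continuous continuous_const
  have hloc : ∀ z ∈ R, ∃ U : Set ℂ, IsOpen U ∧ z ∈ U ∧ Set.InjOn (fun z => h.eval z) U := by
    intro z hz
    have hs := h.hasStrictDerivAt z
    have hs' := hs.hasStrictFDerivAt_equiv hz
    exact ⟨(hs'.toOpenPartialHomeomorph _).source, (hs'.toOpenPartialHomeomorph _).open_source,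
      hs'.mem_toOpenPartialHomeomorph_source, by
        simpa using (hs'.toOpenPartialHomeomorph _).injOn⟩
  choose! U hUo hzU hUi using hloc
  obtain ⟨T, hTc, hT⟩ := TopologicalSpace.isOpen_iUnion_countable (fun z : R => U z)
    (fun z => hUo z z.2)
  rcases T.eq_empty_or_nonempty with hTe | hTn
  · refine ⟨fun _ => ∅, fun _ => MeasurableSet.empty, fun i j _ => by simp [Function.onFun], ?_,
      fun _ => by simp⟩
    rw [hTe] at hT
    simp only [Set.mem_empty_iff_false, Set.iUnion_of_empty, Set.iUnion_empty] at hT ⊢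
    symm
    rw [Set.eq_empty_iff_forall_notMem]
    intro z hz
    have : z ∈ (⋃ z : R, U z) := Set.mem_iUnion.2 ⟨⟨z, hz⟩, hzU z hz⟩
    rw [← hT] at this
    exact this
  · obtain ⟨e, he⟩ := hTc.exists_eq_range hTn
    refine ⟨disjointed fun k => U (e k) ∩ R, fun k => ?_, disjoint_disjointed _, ?_, fun k => ?_⟩
    · exact MeasurableSet.disjointed (fun k => ((hUo _ (e k).2).inter hRo).measurableSet) k
    · rw [iUnion_disjointed]
      ext z
      constructor
      · intro hz
        obtain ⟨k, hk⟩ := Set.mem_iUnion.1 hz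
        exact hk.2
      · intro hz
        have : z ∈ (⋃ z : R, U z) := Set.mem_iUnion.2 ⟨⟨z, hz⟩, hzU z hz⟩
        rw [← hT, he] at this
        simp only [Set.mem_range, Set.iUnion_exists, Set.iUnion_iUnion_eq'] at this
        obtain ⟨k, hk⟩ := Set.mem_iUnion.1 this
        exact Set.mem_iUnion.2 ⟨k, hk, hz⟩
    · exact (hUi _ (e k).2).mono ((disjointed_subset _ k).trans Set.inter_subset_left)

open Polynomial in
/-- Off the critical values the roots of `h - C c` are simple, so a sum over them that is supported
on a set where `h` is injective has at most one term. -/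
theorem sum_roots_indicator_of_injOn {h : Polynomial ℂ} (g : ℂ → ℝ≥0∞) {S : Set ℂ}
    (hS : Set.InjOn (fun z => h.eval z) S) {c : ℂ} (hne : h - C c ≠ 0)
    (hnd : (h - C c).roots.Nodup) :
    ((h - C c).roots.map (S.indicator g)).sum
      = ((fun z => h.eval z) '' S).indicator (fun c => g (Function.invFunOn (fun z => h.eval z) S c))
          c := by
  classical
  have hmem : ∀ z, z ∈ (h - C c).roots ↔ h.eval z = c := by
    intro z
    rw [mem_roots hne, IsRoot.def, eval_sub, eval_C, sub_eq_zero]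
  by_cases hc : c ∈ (fun z => h.eval z) '' S
  · rw [Set.indicator_of_mem hc]
    set z := Function.invFunOn (fun z => h.eval z) S c
    have hzS : z ∈ S := Function.invFunOn_mem hc
    have hz : h.eval z = c := Function.invFunOn_eq hc
    obtain ⟨m, hm⟩ := Multiset.exists_cons_of_mem ((hmem z).2 hz)
    rw [hm] at hnd ⊢
    rw [Multiset.map_cons, Multiset.sum_cons, Set.indicator_of_mem hzS]
    have : (m.map (S.indicator g)).sum = 0 := by
      refine Multiset.sum_eq_zero fun y hy => ?_
      obtain ⟨w, hw, rfl⟩ := Multiset.mem_map.1 hy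
      refine Set.indicator_of_notMem (fun hwS => ?_) _
      have hw' : h.eval w = c := (hmem w).1 (by rw [hm]; exact Multiset.mem_cons_of_mem hw)
      have : w = z := hS hwS hzS (hw'.trans hz.symm)
      exact (Multiset.nodup_cons.1 hnd).1 (this ▸ hw)
    rw [this, add_zero]
  · rw [Set.indicator_of_notMem hc]
    refine Multiset.sum_eq_zero fun y hy => ?_
    obtain ⟨w, hw, rfl⟩ := Multiset.mem_map.1 hy
    exact Set.indicator_of_notMem (fun hwS => hc ⟨w, hwS, (hmem w).1 hw⟩) _

open Polynomial in
/-- Area formula for a complex polynomial `h`: counted with multiplicity, the preimages of Lebesgue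
measure weigh `g` by the real Jacobian `‖h'‖ ^ 2`. -/
theorem lintegral_sum_roots_sub_C (h : Polynomial ℂ) (g : ℂ → ℝ≥0∞) (hg : Measurable g) :
    ∫⁻ c, ((h - C c).roots.map g).sum
      = ∫⁻ z, ENNReal.ofReal (‖h.derivative.eval z‖ ^ 2) * g z := by
  by_cases hd : h.derivative = 0
  · obtain ⟨k, rfl⟩ : ∃ k, h = C k := ⟨_, eq_C_of_derivative_eq_zero hd⟩
    have : ∀ c, (C k - C c).roots = 0 := fun c => by rw [← C_sub, roots_C]
    simp [this]
  obtain ⟨S, hSm, hSd, hSu, hSi⟩ := exists_partition_injOn h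
  have hne : ∀ c, h - C c ≠ 0 := by
    intro c hc
    exact hd (by simpa using congrArg derivative hc)
  have hmem : ∀ c z, z ∈ (h - C c).roots ↔ h.eval z = c := by
    intro c z
    rw [mem_roots (hne c), IsRoot.def, eval_sub, eval_C, sub_eq_zero]
  -- Critical values are finitely many, so almost every fibre consists of simple roots.
  have hcrit : ∀ᵐ c : ℂ, c ∉ {c : ℂ | ∃ z, h.derivative.eval z = 0 ∧ h.eval z = c} :=
    (finite_eval_critical_points hd).measure_zero volume |> measure_eq_zero_iff_ae_notMem.1
  have hnd : ∀ c, c ∉ {c : ℂ | ∃ z, h.derivative.eval z = 0 ∧ h.eval z = c} →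
      (h - C c).roots.Nodup := by
    intro c hc
    rw [Multiset.nodup_iff_count_le_one]
    intro z
    rw [count_roots]
    by_contra hlt
    have h2 := (one_lt_rootMultiplicity_iff_isRoot (hne c)).1 (not_le.1 hlt)
    refine hc ⟨z, ?_, ?_⟩
    · simpa using h2.2
    · have := h2.1
      rwa [IsRoot.def, eval_sub, eval_C, sub_eq_zero] at this
  have hind : ∀ z, h.derivative.eval z ≠ 0 → g z = ∑' k, (S k).indicator g z := by
    intro z hz
    have : z ∈ ⋃ k, S k := by rw [hSu]; exact hz
    obtain ⟨k, hk⟩ := Set.mem_iUnion.1 this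
    rw [tsum_eq_single k fun j hj => Set.indicator_of_notMem
      (fun hzj => Set.disjoint_left.1 (hSd hj) hzj hk) _, Set.indicator_of_mem hk]
  have hsum : ∀ᵐ c : ℂ, ((h - C c).roots.map g).sum =
      ∑' k, ((fun z => h.eval z) '' S k).indicator
        (fun c => g (Function.invFunOn (fun z => h.eval z) (S k) c)) c := by
    filter_upwards [hcrit] with c hc
    simp_rw [← sum_roots_indicator_of_injOn g (hSi _) (hne c) (hnd c hc)]
    have hS : ∀ m : Multiset ℂ, (∀ z ∈ m, h.derivative.eval z ≠ 0) →
        (m.map g).sum = ∑' k, (m.map ((S k).indicator g)).sum := by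
      intro m
      induction m using Multiset.induction with
      | empty => simp
      | cons z m ih =>
        intro hm
        simp only [Multiset.map_cons, Multiset.sum_cons]
        rw [ENNReal.tsum_add, ← ih fun w hw => hm w (Multiset.mem_cons_of_mem hw),
          ← hind z (hm z (Multiset.mem_cons_self z m))]
    exact hS _ fun z hz h0 => hc ⟨z, h0, (hmem c z).1 hz⟩
  have hderiv : ∀ k, ∀ z ∈ S k, HasFDerivWithinAt (fun z => h.eval z)
      (((ContinuousLinearMap.toSpanSingleton ℂ (h.derivative.eval z) : ℂ →L[ℂ] ℂ)).restrictScalars ℝ)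
      (S k) z := fun k z _ =>
    ((h.hasDerivAt z).hasFDerivAt.restrictScalars ℝ).hasFDerivWithinAt
  have hdet : ∀ z : ℂ, ENNReal.ofReal |(((ContinuousLinearMap.toSpanSingleton ℂ
      (h.derivative.eval z) : ℂ →L[ℂ] ℂ)).restrictScalars ℝ).det|
        = ENNReal.ofReal (‖h.derivative.eval z‖ ^ 2) := by
    intro z
    have : ((((ContinuousLinearMap.toSpanSingleton ℂ
      (h.derivative.eval z) : ℂ →L[ℂ] ℂ)).restrictScalars ℝ)).det = ‖h.derivative.eval z‖ ^ 2 := by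
      have h1 : ((ContinuousLinearMap.toSpanSingleton ℂ
        (h.derivative.eval z) : ℂ →L[ℂ] ℂ) : ℂ →ₗ[ℂ] ℂ).det = h.derivative.eval z := by
        rw [← LinearMap.det_toMatrix (Module.Basis.singleton Unit ℂ)]
        simp [Matrix.det_unique, LinearMap.toMatrix_apply]
      have h2 := LinearMap.det_restrictScalars (R := ℝ) (S := ℂ) (f := ((ContinuousLinearMap.toSpanSingleton ℂ
        (h.derivative.eval z) : ℂ →L[ℂ] ℂ) : ℂ →ₗ[ℂ] ℂ))
      rw [h1, Algebra.norm_complex_eq] at h2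
      rw [ContinuousLinearMap.det]
      simpa [Complex.normSq_eq_norm_sq] using h2
    rw [this, abs_of_nonneg (by positivity)]
  have hpiece : ∀ k, ∫⁻ c, ((fun z => h.eval z) '' S k).indicator
        (fun c => g (Function.invFunOn (fun z => h.eval z) (S k) c)) c
      = ∫⁻ z, (S k).indicator (fun z => ENNReal.ofReal (‖h.derivative.eval z‖ ^ 2) * g z) z := by
    intro k
    have him : MeasurableSet ((fun z => h.eval z) '' S k) :=
      measurable_image_of_fderivWithin (hSm k) (hderiv k) (hSi k)
    rw [lintegral_indicator him, lintegral_indicator (hSm k),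
      lintegral_image_eq_lintegral_abs_det_fderiv_mul volume (hSm k) (hderiv k) (hSi k)]
    refine setLIntegral_congr_fun (hSm k) fun z hz => ?_
    rw [hdet, (hSi k).leftInvOn_invFunOn hz]
  have hmeas : ∀ k, Measurable (((fun z => h.eval z) '' S k).indicator
        (fun c => g (Function.invFunOn (fun z => h.eval z) (S k) c))) := by
    intro k
    have hemb := measurableEmbedding_of_fderivWithin (hSm k) (hderiv k) (hSi k)
    have hext := hemb.measurable_extend (hg.comp measurable_subtype_coe)
      (measurable_const (a := (0 : ℝ≥0∞)))
    convert hext using 1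
    funext c
    by_cases hc : c ∈ (fun z => h.eval z) '' S k
    · obtain ⟨z, hz, rfl⟩ := hc
      rw [Set.indicator_of_mem (Set.mem_image_of_mem _ hz), (hSi k).leftInvOn_invFunOn hz]
      exact (hemb.injective.extend_apply (g ∘ Subtype.val) (fun _ => 0) ⟨z, hz⟩).symm
    · rw [Set.indicator_of_notMem hc, Function.extend_apply']
      rintro ⟨⟨z, hz⟩, hzc⟩
      exact hc ⟨z, hz, hzc⟩
  rw [lintegral_congr_ae hsum, lintegral_tsum fun k => (hmeas k).aemeasurable]
  simp_rw [hpiece]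
  have hmeas' : Measurable fun z => ENNReal.ofReal (‖h.derivative.eval z‖ ^ 2) * g z := by
    have := h.derivative.continuous.measurable
    fun_prop
  rw [← lintegral_tsum fun k => (hmeas'.indicator (hSm k)).aemeasurable]
  refine lintegral_congr fun z => ?_
  by_cases hz : h.derivative.eval z = 0
  · simp [hz]
  · rw [hind z hz, ← ENNReal.tsum_mul_left]
    refine tsum_congr fun k => ?_
    by_cases hzk : z ∈ S k
    · simp only [Set.indicator_of_mem hzk]
    · simp only [Set.indicator_of_notMem hzk, mul_zero]

/-! ### Gaussian moments of two linear forms -/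

theorem lintegral_norm_add_sum_mul_sq {n : ℕ} (x : ℂ) (β : Fin n → ℂ) :
    ∫⁻ y, ENNReal.ofReal (‖x + ∑ i, β i * y i‖ ^ 2) ∂(gaussianVector n)
      = ENNReal.ofReal (‖x‖ ^ 2 + ∑ i, ‖β i‖ ^ 2) := by
  induction n with
  | zero => simp
  | succ n ih =>
    rw [lintegral_pi_finCons _ _ (by fun_prop)]
    simp only [Fin.sum_univ_succ, Fin.cons_zero, Fin.cons_succ]
    have : ∀ y : Fin n → ℂ, ∫⁻ c, ENNReal.ofReal (‖x + (β 0 * c + ∑ i : Fin n, β i.succ * y i)‖ ^ 2)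
        ∂stdComplexGaussian = ENNReal.ofReal (‖x + ∑ i : Fin n, β i.succ * y i‖ ^ 2)
          + ENNReal.ofReal (‖β 0‖ ^ 2) := by
      intro y
      rw [← ENNReal.ofReal_add (by positivity) (by positivity), ← lintegral_norm_add_mul_sq]
      refine lintegral_congr fun c => ?_
      congr 3
      ring
    simp_rw [this]
    rw [lintegral_add_right _ (by fun_prop), ih]
    simp only [lintegral_const, measure_univ, mul_one]
    rw [← ENNReal.ofReal_add (by positivity) (by positivity)]
    congr 1
    ring

/-- A unitary matrix turning the linear form `α` into a multiple of the first coordinate. -/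
theorem exists_unitary_sum_mul_eq {n : ℕ} {α : Fin (n + 1) → ℂ} (hα : 0 < ∑ i, ‖α i‖ ^ 2) :
    ∃ U : Matrix (Fin (n + 1)) (Fin (n + 1)) ℂ, U.conjTranspose * U = 1 ∧
      (∀ i, U i 0 = star (α i) / (Real.sqrt (∑ i, ‖α i‖ ^ 2) : ℝ)) ∧
      ∀ j, j ≠ 0 → ∑ i, α i * U i j = 0 := by
  set a : EuclideanSpace ℂ (Fin (n + 1)) := WithLp.toLp 2 fun i => star (α i) with ha
  have hnorm : ‖a‖ = Real.sqrt (∑ i, ‖α i‖ ^ 2) := by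
    rw [EuclideanSpace.norm_eq]
    simp [ha]
  have hpos : 0 < ‖a‖ := by rw [hnorm]; exact Real.sqrt_pos.2 hα
  set v : Fin (n + 1) → EuclideanSpace ℂ (Fin (n + 1)) := fun _ => ((‖a‖⁻¹ : ℝ) : ℂ) • a with hv
  have hvn : ‖v 0‖ = 1 := by
    rw [hv]
    simp only [norm_smul, Complex.norm_real, norm_inv, norm_norm]
    exact inv_mul_cancel₀ hpos.ne'
  have ho : Orthonormal ℂ (({0} : Set (Fin (n + 1))).domRestrict v) := by
    constructor
    · rintro ⟨i, hi⟩
      exact hvn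
    · rintro ⟨i, hi⟩ ⟨j, hj⟩ hij
      exact absurd (Subtype.ext ((Set.mem_singleton_iff.1 hi).trans (Set.mem_singleton_iff.1 hj).symm))
        hij
  obtain ⟨u, hu⟩ := ho.exists_orthonormalBasis_extension_of_card_eq (by simp)
  have hu0 : u 0 = v 0 := hu 0 rfl
  have hinner : ∀ j l, ∑ i, star (u j i) * u l i = if j = l then 1 else 0 := by
    intro j l
    rw [← orthonormal_iff_ite.1 u.orthonormal j l, PiLp.inner_apply]
    refine Finset.sum_congr rfl fun i _ => ?_
    simp [mul_comm]
  have hcol : ∀ i, u 0 i = star (α i) / (Real.sqrt (∑ i, ‖α i‖ ^ 2) : ℝ) := by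
    intro i
    rw [hu0, ← hnorm]
    simp [hv, ha, div_eq_inv_mul]
  refine ⟨Matrix.of fun i j => u j i, ?_, hcol, fun j hj => ?_⟩
  · ext j l
    rw [Matrix.mul_apply, Matrix.one_apply, ← hinner]
    simp
  · have h := hinner 0 j
    rw [if_neg (Ne.symm hj)] at h
    simp only [hcol] at h
    have hc : ((Real.sqrt (∑ i, ‖α i‖ ^ 2) : ℝ) : ℂ) ≠ 0 := by
      rw [← hnorm]; exact_mod_cast hpos.ne'
    have h' : ∑ i, α i * u j i = (Real.sqrt (∑ i, ‖α i‖ ^ 2) : ℝ) *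
        ∑ i, star (star (α i) / (Real.sqrt (∑ i, ‖α i‖ ^ 2) : ℝ)) * u j i := by
      rw [Finset.mul_sum]
      refine Finset.sum_congr rfl fun i _ => ?_
      have : star ((Real.sqrt (∑ i, ‖α i‖ ^ 2) : ℝ) : ℂ) = (Real.sqrt (∑ i, ‖α i‖ ^ 2) : ℝ) :=
        Complex.conj_ofReal _
      rw [star_div₀, star_star, this]
      field_simp
    simp only [Matrix.of_apply]
    rw [h', h, mul_zero]

theorem lintegral_pi_finCons' {n : ℕ} (μ : Measure ℂ) [SigmaFinite μ]
    (f : (Fin (n + 1) → ℂ) → ℝ≥0∞) (hf : Measurable f) :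
    ∫⁻ x, f x ∂(Measure.pi fun _ => μ)
      = ∫⁻ c, ∫⁻ y, f (Fin.cons c y) ∂(Measure.pi fun _ : Fin n => μ) ∂μ := by
  rw [lintegral_pi_finCons μ f hf, lintegral_lintegral_swap]
  exact (hf.comp (measurable_finCons.comp measurable_swap)).aemeasurable

/-- The special case of `lintegral_two_linear_forms` in which the first form is a multiple of the first
coordinate. -/
theorem lintegral_first_coord_mul_linear_form {n : ℕ} (s : ℂ) (β : Fin (n + 1) → ℂ) :
    ∫⁻ b, ENNReal.ofReal (Real.exp (-‖s * b 0‖ ^ 2)) *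
        (ENNReal.ofReal (‖s * b 0‖ ^ 2) * ENNReal.ofReal (‖∑ i, β i * b i‖ ^ 2))
        ∂(gaussianVector (n + 1))
      = ENNReal.ofReal (2 * (‖s‖ ^ 2 * ‖β 0‖ ^ 2) / (1 + ‖s‖ ^ 2) ^ 3 +
          (‖s‖ ^ 2 * ∑ j : Fin n, ‖β j.succ‖ ^ 2) / (1 + ‖s‖ ^ 2) ^ 2) := by
  rw [lintegral_pi_finCons' _ _ (by fun_prop)]
  simp only [Fin.sum_univ_succ, Fin.cons_zero, Fin.cons_succ]
  have h0 : (0 : ℝ) ≤ ∑ j : Fin n, ‖β j.succ‖ ^ 2 := Finset.sum_nonneg fun _ _ => sq_nonneg _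
  have hs : (0 : ℝ) ≤ ‖s‖ ^ 2 := sq_nonneg _
  have hin : ∀ c : ℂ, ∫⁻ y : Fin n → ℂ, ENNReal.ofReal (Real.exp (-‖s * c‖ ^ 2)) *
      (ENNReal.ofReal (‖s * c‖ ^ 2) *
        ENNReal.ofReal (‖β 0 * c + ∑ j : Fin n, β j.succ * y j‖ ^ 2)) ∂(gaussianVector n)
      = ENNReal.ofReal (‖s‖ ^ 2 * ‖β 0‖ ^ 2) *
          ENNReal.ofReal ((‖c‖ ^ 2) ^ 2 * Real.exp (-(‖s‖ ^ 2 * ‖c‖ ^ 2)))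
        + ENNReal.ofReal (‖s‖ ^ 2 * ∑ j : Fin n, ‖β j.succ‖ ^ 2) *
          ENNReal.ofReal ((‖c‖ ^ 2) ^ 1 * Real.exp (-(‖s‖ ^ 2 * ‖c‖ ^ 2))) := by
    intro c
    rw [lintegral_const_mul _ (by fun_prop), lintegral_const_mul _ (by fun_prop),
      lintegral_norm_add_sum_mul_sq, ← ENNReal.ofReal_mul (by positivity),
      ← ENNReal.ofReal_mul (by positivity), ← ENNReal.ofReal_mul (by positivity),
      ← ENNReal.ofReal_mul (by positivity), ← ENNReal.ofReal_add (by positivity) (by positivity)]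
    congr 1
    simp only [norm_mul, mul_pow]
    ring
  rw [lintegral_congr hin, lintegral_add_left (by fun_prop), lintegral_const_mul _ (by fun_prop),
    lintegral_const_mul _ (by fun_prop), lintegral_norm_pow_mul_exp_stdComplexGaussian 2 hs,
    lintegral_norm_pow_mul_exp_stdComplexGaussian 1 hs]
  rw [← ENNReal.ofReal_mul (by positivity),
      ← ENNReal.ofReal_mul (by positivity), ← ENNReal.ofReal_add (by positivity) (by positivity)]
  congr 1
  simp [Nat.factorial]
  ring

/-- The Gaussian moment that gives the density of a second zero. A unitary change of variables makes
the form `α` depend on one coordinate, and `β` splits into a multiple of `α` and an independent rest. -/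
theorem lintegral_two_linear_forms {n : ℕ} (α β : Fin n → ℂ) :
    ∫⁻ b, ENNReal.ofReal (Real.exp (-‖∑ i, α i * b i‖ ^ 2)) *
        (ENNReal.ofReal (‖∑ i, α i * b i‖ ^ 2) * ENNReal.ofReal (‖∑ i, β i * b i‖ ^ 2))
        ∂(gaussianVector n)
      = ENNReal.ofReal (2 * ‖∑ i, β i * star (α i)‖ ^ 2 / (1 + ∑ i, ‖α i‖ ^ 2) ^ 3 +
          ((∑ i, ‖α i‖ ^ 2) * (∑ i, ‖β i‖ ^ 2) - ‖∑ i, β i * star (α i)‖ ^ 2) /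
            (1 + ∑ i, ‖α i‖ ^ 2) ^ 2) := by
  rcases (Finset.sum_nonneg fun i _ => sq_nonneg ‖α i‖ :
    0 ≤ ∑ i, ‖α i‖ ^ 2).eq_or_lt with h0 | hpos
  · have hα : ∀ i, α i = 0 := by
      intro i
      have := (Finset.sum_eq_zero_iff_of_nonneg fun i _ => sq_nonneg ‖α i‖).1 h0.symm i
        (Finset.mem_univ i)
      simpa using this
    simp [hα]
  obtain _ | n := n
  · simp at hpos
  obtain ⟨U, hU, hU0, hUj⟩ := exists_unitary_sum_mul_eq hpos
  set A := ∑ i, ‖α i‖ ^ 2 with hA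
  set β' : Fin (n + 1) → ℂ := fun j => ∑ i, β i * U i j with hβ'
  have hsq : ((Real.sqrt A : ℝ) : ℂ) ≠ 0 := by exact_mod_cast (Real.sqrt_pos.2 hpos).ne'
  have hsq2 : ((Real.sqrt A : ℝ) : ℂ) * ((Real.sqrt A : ℝ) : ℂ) = A := by
    rw [← Complex.ofReal_mul, Real.mul_self_sqrt hpos.le]
  have hform : ∀ (γ c : Fin (n + 1) → ℂ), ∑ i, γ i * U.mulVec c i = ∑ j, (∑ i, γ i * U i j) * c j := by
    intro γ c
    simp only [Matrix.mulVec, dotProduct, Finset.mul_sum, Finset.sum_mul]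
    rw [Finset.sum_comm]
    refine Finset.sum_congr rfl fun i _ => Finset.sum_congr rfl fun j _ => by ring
  have hα0 : ∑ i, α i * U i 0 = (Real.sqrt A : ℝ) := by
    have : ∀ i, α i * U i 0 = ((‖α i‖ ^ 2 : ℝ) : ℂ) / (Real.sqrt A : ℝ) := by
      intro i
      rw [hU0, ← mul_div_assoc, RCLike.star_def, Complex.mul_conj, Complex.normSq_eq_norm_sq]
    simp_rw [this]
    rw [← Finset.sum_div, ← Complex.ofReal_sum, ← hA, div_eq_iff hsq, hsq2]
  have hαc : ∀ c, ∑ i, α i * U.mulVec c i = (Real.sqrt A : ℝ) * c 0 := by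
    intro c
    rw [hform, Fin.sum_univ_succ, hα0, Finset.sum_eq_zero fun j _ => ?_, add_zero]
    rw [hUj _ (Fin.succ_ne_zero j), zero_mul]
  have hβ0 : A * ‖β' 0‖ ^ 2 = ‖∑ i, β i * star (α i)‖ ^ 2 := by
    have : ∑ i, β i * star (α i) = (Real.sqrt A : ℝ) * β' 0 := by
      rw [hβ', Finset.mul_sum]
      refine Finset.sum_congr rfl fun i _ => ?_
      rw [hU0]
      field_simp
    rw [this, norm_mul, mul_pow, Complex.norm_real, Real.norm_of_nonneg (Real.sqrt_nonneg _),
      Real.sq_sqrt hpos.le]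
  have hβsum : ∑ j, ‖β' j‖ ^ 2 = ∑ i, ‖β i‖ ^ 2 := by
    have hUt : U.transpose.conjTranspose * U.transpose = 1 := by
      have h1 : U * U.conjTranspose = 1 := mul_eq_one_comm.1 hU
      have h2 := congrArg Matrix.transpose h1
      rw [Matrix.transpose_mul, Matrix.transpose_one] at h2
      exact h2
    rw [← sum_norm_sq_mulVec hUt β]
    refine Finset.sum_congr rfl fun j _ => ?_
    simp [hβ', Matrix.mulVec, dotProduct, mul_comm]
  rw [← lintegral_gaussianVector_comp_mulVec hU _ (by fun_prop)]
  have hβc : ∀ c, ∑ i, β i * U.mulVec c i = ∑ j, β' j * c j := hform β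
  have hsplit : ∑ j, ‖β' j‖ ^ 2 = ‖β' 0‖ ^ 2 + ∑ j : Fin n, ‖β' j.succ‖ ^ 2 :=
    Fin.sum_univ_succ _
  simp only [hαc, hβc]
  rw [lintegral_first_coord_mul_linear_form, Complex.norm_real,
    Real.norm_of_nonneg (Real.sqrt_nonneg _), Real.sq_sqrt hpos.le, ← hβ0, ← hβsum, hsplit]
  congr 3
  ring

/-! ### Root sums as measurable functions of the coefficients -/

theorem coeff_ellipticPoly {N : ℕ} (a : Fin (N + 1) → ℂ) (n : Fin (N + 1)) :
    (ellipticPoly N a).coeff n = a n * ((Real.sqrt (N.choose n) : ℝ) : ℂ) := by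
  rw [ellipticPoly, Polynomial.finsetSum_coeff, Finset.sum_eq_single n]
  · simp
  · intro m _ hm
    rw [Polynomial.coeff_monomial, if_neg fun h => hm (Fin.ext h)]
  · simp

theorem natDegree_ellipticPoly_le {N : ℕ} (a : Fin (N + 1) → ℂ) :
    (ellipticPoly N a).natDegree ≤ N :=
  Polynomial.natDegree_sum_le_of_forall_le _ _ fun n _ =>
    (Polynomial.natDegree_monomial_le _).trans (Nat.lt_succ_iff.1 n.2)

theorem sqrt_choose_ne_zero {N : ℕ} (n : Fin (N + 1)) :
    ((Real.sqrt (N.choose n) : ℝ) : ℂ) ≠ 0 := by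
  have : 0 < N.choose n := Nat.choose_pos (Nat.lt_succ_iff.1 n.2)
  exact_mod_cast (Real.sqrt_pos.2 (by exact_mod_cast this)).ne'

theorem eval_ellipticPoly {N : ℕ} (a : Fin (N + 1) → ℂ) (w : ℂ) :
    (ellipticPoly N a).eval w = ∑ n, a n * ((Real.sqrt (N.choose n) : ℝ) : ℂ) * w ^ (n : ℕ) := by
  simp [ellipticPoly, Polynomial.eval_finsetSum]

theorem ellipticPoly_eq_of_coeff {N : ℕ} {p : Polynomial ℂ} (hp : p.natDegree ≤ N) :
    ellipticPoly N (fun n => p.coeff n / ((Real.sqrt (N.choose n) : ℝ) : ℂ)) = p := by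
  ext k
  by_cases hk : k < N + 1
  · rw [coeff_ellipticPoly _ ⟨k, hk⟩]
    exact div_mul_cancel₀ _ (sqrt_choose_ne_zero ⟨k, hk⟩)
  · rw [Polynomial.coeff_eq_zero_of_natDegree_lt, Polynomial.coeff_eq_zero_of_natDegree_lt]
    · omega
    · exact (natDegree_ellipticPoly_le _).trans_lt (by omega)

theorem natDegree_ellipticPoly {N : ℕ} {a : Fin (N + 1) → ℂ} (ha : a (Fin.last N) ≠ 0) :
    (ellipticPoly N a).natDegree = N := by
  refine le_antisymm (natDegree_ellipticPoly_le a) (Polynomial.le_natDegree_of_ne_zero ?_)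
  have := coeff_ellipticPoly a (Fin.last N)
  rw [Fin.val_last] at this
  rw [this]
  simpa using ha

theorem ellipticPoly_ne_zero {N : ℕ} {a : Fin (N + 1) → ℂ} (ha : a (Fin.last N) ≠ 0) :
    ellipticPoly N a ≠ 0 := by
  intro h
  have := coeff_ellipticPoly a (Fin.last N)
  rw [h] at this
  simp at this
  exact ha this.symm

theorem exists_fin_map_eq {α : Type*} {N : ℕ} (m : Multiset α) (hm : m.card = N) :
    ∃ ζ : Fin N → α, (Finset.univ : Finset (Fin N)).val.map ζ = m := by
  subst hm
  induction m using Quotient.inductionOn with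
  | h l => exact ⟨l.get, (Fin.univ_val_map l.get).trans (congrArg _ (List.ofFn_get l))⟩

/-- A polynomial with nonzero top coefficient is its top coefficient times the product over an
enumeration of its roots. -/
theorem exists_roots_ellipticPoly {N : ℕ} {a : Fin (N + 1) → ℂ} (ha : a (Fin.last N) ≠ 0) :
    ∃ ζ : Fin N → ℂ, (Finset.univ : Finset (Fin N)).val.map ζ = (ellipticPoly N a).roots ∧
      ellipticPoly N a = Polynomial.C (a (Fin.last N)) * ∏ i, (Polynomial.X - Polynomial.C (ζ i)) := by
  have hs := IsAlgClosed.splits (ellipticPoly N a)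
  obtain ⟨ζ, hζ⟩ := exists_fin_map_eq (N := N) (ellipticPoly N a).roots
    (by rw [← hs.natDegree_eq_card_roots, natDegree_ellipticPoly ha])
  refine ⟨ζ, hζ, ?_⟩
  have hl : (ellipticPoly N a).leadingCoeff = a (Fin.last N) := by
    rw [Polynomial.leadingCoeff, natDegree_ellipticPoly ha]
    have := coeff_ellipticPoly a (Fin.last N)
    rw [Fin.val_last] at this
    simpa using this
  have h := hs.eq_prod_roots
  rw [hl, ← hζ, Multiset.map_map] at h
  exact h

open Classical in
/-- The sum of `φ` over the roots, with multiplicity, of the elliptic polynomial with coefficients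
`a`; by convention `0` when the degree drops below `N`. -/
noncomputable def rootSum {N : ℕ} (φ : ℂ → ℝ≥0∞) (a : Fin (N + 1) → ℂ) : ℝ≥0∞ :=
  if a (Fin.last N) = 0 then 0 else ((ellipticPoly N a).roots.map φ).sum

theorem measurable_coeff_prod_X_sub_C {N : ℕ} (s : Finset (Fin N)) (k : ℕ) :
    Measurable fun ζ : Fin N → ℂ =>
      (∏ i ∈ s, (Polynomial.X - Polynomial.C (ζ i))).coeff k := by
  classical
  induction s using Finset.induction_on generalizing k with
  | empty => simp
  | insert i s hi ih =>
    simp only [Finset.prod_insert hi, Polynomial.coeff_mul]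
    refine Finset.measurable_sum _ fun p _ => Measurable.mul ?_ (ih _)
    simp only [Polynomial.coeff_sub, Polynomial.coeff_X, Polynomial.coeff_C]
    split_ifs <;> fun_prop

/-- A root sum is a Borel function of the coefficients: it becomes one after composition with the
surjective Borel map from roots to coefficients, which suffices by Suslin's theorem. -/
theorem measurable_rootSum {N : ℕ} {Y : Type*} [MeasurableSpace Y] [StandardBorelSpace Y]
    (φ : Y → ℂ → ℝ≥0∞) (hφ : Measurable (Function.uncurry φ)) :
    Measurable fun p : Y × (Fin (N + 1) → ℂ) => rootSum (φ p.1) p.2 := by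
  have hs : MeasurableSet {c : ℂ | c ≠ 0} := (measurableSet_singleton 0).compl
  have : StandardBorelSpace {c : ℂ // c ≠ 0} := hs.standardBorel
  set Z : Set (Y × (Fin (N + 1) → ℂ)) := {p | p.2 (Fin.last N) ≠ 0} with hZ
  have hZm : MeasurableSet Z :=
    measurableSet_preimage (t := {c : ℂ | c ≠ 0})
      (f := fun p : Y × (Fin (N + 1) → ℂ) => p.2 (Fin.last N)) (by fun_prop) hs
  set q : ℂ → (Fin N → ℂ) → Polynomial ℂ := fun c ζ =>
    Polynomial.C c * ∏ i, (Polynomial.X - Polynomial.C (ζ i)) with hq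
  have hqd : ∀ c ζ, (q c ζ).natDegree ≤ N := by
    intro c ζ
    refine (Polynomial.natDegree_C_mul_le _ _).trans ?_
    simp
  have hql : ∀ c ζ, (q c ζ).coeff N = c := by
    intro c ζ
    have hm : (∏ i, (Polynomial.X - Polynomial.C (ζ i))).Monic :=
      Polynomial.monic_prod_of_monic _ _ fun i _ => Polynomial.monic_X_sub_C _
    have hd : (∏ i, (Polynomial.X - Polynomial.C (ζ i))).natDegree = N := by
      rw [Polynomial.natDegree_prod_of_monic _ _ fun i _ => Polynomial.monic_X_sub_C _]
      simp
    have := hm.coeff_natDegree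
    rw [hd] at this
    rw [hq, Polynomial.coeff_C_mul, this, mul_one]
  set V : Y × {c : ℂ // c ≠ 0} × (Fin N → ℂ) → Z := fun p =>
    ⟨(p.1, fun n => (q p.2.1 p.2.2).coeff n / ((Real.sqrt (N.choose n) : ℝ) : ℂ)), by
      simp only [hZ, Set.mem_ofPred_eq, Fin.val_last, hql]
      simpa using p.2.1.2⟩ with hV
  have hVp : ∀ p, ellipticPoly N (V p).1.2 = q p.2.1 p.2.2 := fun p =>
    ellipticPoly_eq_of_coeff (hqd _ _)
  have hVm : Measurable V := by
    refine Measurable.subtype_mk (Measurable.prodMk measurable_fst (measurable_pi_iff.2 fun n => ?_))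
    simp only [hq, Polynomial.coeff_C_mul]
    refine Measurable.div_const (Measurable.mul ?_ ?_) _
    · exact measurable_subtype_coe.comp (measurable_fst.comp measurable_snd)
    · exact (measurable_coeff_prod_X_sub_C Finset.univ _).comp (measurable_snd.comp measurable_snd)
  have hVs : Function.Surjective V := by
    rintro ⟨⟨y, a⟩, ha⟩
    obtain ⟨ζ, -, hζ⟩ := exists_roots_ellipticPoly ha
    refine ⟨(y, ⟨a (Fin.last N), ha⟩, ζ), Subtype.ext (Prod.ext rfl ?_)⟩
    funext n
    simp only [hV, hq]
    rw [← hζ, coeff_ellipticPoly, mul_div_cancel_right₀ _ (sqrt_choose_ne_zero n)]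
  have hres : Measurable fun p : Z => rootSum (φ p.1.1) p.1.2 := by
    rw [← hVm.measurable_comp_iff_of_surjective hVs]
    have : (fun p : Z => rootSum (φ p.1.1) p.1.2) ∘ V = fun p => ∑ i, φ p.1 (p.2.2 i) := by
      funext p
      have hroots : (ellipticPoly N (V p).1.2).roots =
          (Finset.univ : Finset (Fin N)).val.map p.2.2 := by
        rw [hVp, hq, Polynomial.roots_C_mul _ p.2.1.2, show (∏ i, (Polynomial.X - Polynomial.C (p.2.2 i)))
            = (((Finset.univ : Finset (Fin N)).val.map p.2.2).map fun a =>
              Polynomial.X - Polynomial.C a).prod by rw [Multiset.map_map]; rfl,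
            Polynomial.roots_multiset_prod_X_sub_C]
      simp only [Function.comp_apply, rootSum]
      rw [if_neg (V p).2, hroots, Multiset.map_map]
      rfl
    rw [this]
    refine Finset.measurable_sum _ fun i _ => hφ.comp (Measurable.prodMk measurable_fst ?_)
    exact (measurable_pi_apply i).comp (measurable_snd.comp measurable_snd)
  have hzero : Measurable fun p : (Zᶜ : Set _) => rootSum (φ p.1.1) p.1.2 := by
    have : (fun p : (Zᶜ : Set _) => rootSum (φ p.1.1) p.1.2) = fun _ => 0 := by
      funext p
      have hp : p.1.2 (Fin.last N) = 0 := not_not.1 p.2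
      simp [rootSum, hp]
    rw [this]
    exact measurable_const
  exact measurable_of_restrict_of_restrict_compl hZm hres hzero

/-! ### Rotations of the sphere acting on elliptic polynomials -/

open Polynomial in
/-- The basis polynomial `(X - z) ^ n * (1 + conj z * X) ^ (N - n)`, which is `X ^ n` transported by
the rotation of the sphere sending `z` to `0`. -/
noncomputable def rotatedMonomial (N : ℕ) (z : ℂ) (n : ℕ) : Polynomial ℂ :=
  (X - C z) ^ n * (1 + C (star z) * X) ^ (N - n)

/-- The matrix, in the basis of the elliptic polynomials, of
`p ↦ ((1 + conj z * w) / √(1 + ‖z‖ ^ 2)) ^ N * p ((w - z) / (1 + conj z * w))`. -/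
noncomputable def rotationMatrix (N : ℕ) (z : ℂ) : Matrix (Fin (N + 1)) (Fin (N + 1)) ℂ :=
  Matrix.of fun k n => (((Real.sqrt (1 + ‖z‖ ^ 2) : ℝ) : ℂ) ^ N)⁻¹ *
    (rotatedMonomial N z n).coeff k * ((Real.sqrt (N.choose n) : ℝ) : ℂ) /
      ((Real.sqrt (N.choose k) : ℝ) : ℂ)

open Polynomial in
theorem natDegree_rotatedMonomial_le {N : ℕ} (z : ℂ) {n : ℕ} (hn : n ≤ N) :
    (rotatedMonomial N z n).natDegree ≤ N := by
  refine natDegree_mul_le.trans ?_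
  have h1 : ((X - C z) ^ n).natDegree ≤ n := by
    simp
  have h3 : (1 + C (star z) * X).natDegree ≤ 1 := by
    have := natDegree_linear_le (a := star z) (b := (1 : ℂ))
    rwa [C_1, add_comm] at this
  have h2 : ((1 + C (star z) * X) ^ (N - n)).natDegree ≤ N - n := by
    simpa using natDegree_pow_le_of_le (N - n) h3
  omega

theorem eval_rotatedMonomial (N : ℕ) (z w : ℂ) (n : ℕ) :
    (rotatedMonomial N z n).eval w = (w - z) ^ n * (1 + star z * w) ^ (N - n) := by
  simp [rotatedMonomial]

open Polynomial in
theorem ellipticPoly_rotationMatrix_mulVec (N : ℕ) (z : ℂ) (b : Fin (N + 1) → ℂ) :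
    ellipticPoly N ((rotationMatrix N z).mulVec b)
      = ∑ n : Fin (N + 1), C ((((Real.sqrt (1 + ‖z‖ ^ 2) : ℝ) : ℂ) ^ N)⁻¹ *
        (b n * ((Real.sqrt (N.choose n) : ℝ) : ℂ))) * rotatedMonomial N z n := by
  ext k
  by_cases hk : k < N + 1
  · have h := coeff_ellipticPoly ((rotationMatrix N z).mulVec b) ⟨k, hk⟩
    simp only at h
    rw [h, finsetSum_coeff]
    simp only [Matrix.mulVec, dotProduct, rotationMatrix, Matrix.of_apply, coeff_C_mul]
    rw [Finset.sum_mul]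
    refine Finset.sum_congr rfl fun n _ => ?_
    have := sqrt_choose_ne_zero (N := N) ⟨k, hk⟩
    simp only at this
    field_simp
  · rw [coeff_eq_zero_of_natDegree_lt ((natDegree_ellipticPoly_le _).trans_lt (by omega)),
      finsetSum_coeff, Finset.sum_eq_zero]
    intro n _
    rw [coeff_C_mul, coeff_eq_zero_of_natDegree_lt
      ((natDegree_rotatedMonomial_le z (Nat.lt_succ_iff.1 n.2)).trans_lt (by omega)), mul_zero]

/-- The evaluation vectors of elliptic polynomials separate coefficient vectors. -/
theorem eq_zero_of_forall_sum_eq_zero {N : ℕ} {x : Fin (N + 1) → ℂ}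
    (h : ∀ w : ℂ, ∑ n, x n * ((Real.sqrt (N.choose n) : ℝ) : ℂ) * w ^ (n : ℕ) = 0) : x = 0 := by
  have hp : ellipticPoly N x = 0 := Polynomial.funext fun w => by
    rw [eval_ellipticPoly, h, Polynomial.eval_zero]
  funext n
  have := coeff_ellipticPoly x n
  rw [hp, Polynomial.coeff_zero] at this
  exact (mul_eq_zero.1 this.symm).resolve_right (sqrt_choose_ne_zero n)

theorem sqrt_choose_mul_self {N : ℕ} (n : Fin (N + 1)) :
    ((Real.sqrt (N.choose n) : ℝ) : ℂ) * ((Real.sqrt (N.choose n) : ℝ) : ℂ) = N.choose n := by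
  rw [← Complex.ofReal_mul, Real.mul_self_sqrt (Nat.cast_nonneg _)]
  simp

theorem sqrt_one_add_norm_sq_mul_self (z : ℂ) :
    ((Real.sqrt (1 + ‖z‖ ^ 2) : ℝ) : ℂ) * ((Real.sqrt (1 + ‖z‖ ^ 2) : ℝ) : ℂ) = 1 + z * star z := by
  rw [← Complex.ofReal_mul, Real.mul_self_sqrt (by positivity), RCLike.star_def, Complex.mul_conj,
    Complex.normSq_eq_norm_sq]
  simp

theorem sqrt_one_add_norm_sq_ne_zero (z : ℂ) : ((Real.sqrt (1 + ‖z‖ ^ 2) : ℝ) : ℂ) ≠ 0 := by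
  have : 0 < Real.sqrt (1 + ‖z‖ ^ 2) := Real.sqrt_pos.2 (by positivity)
  exact_mod_cast this.ne'

/-- The rotation matrix is unitary because it preserves the reproducing kernel
`(1 + w * conj w') ^ N`. -/
theorem conjTranspose_mul_rotationMatrix (N : ℕ) (z : ℂ) :
    (rotationMatrix N z).conjTranspose * rotationMatrix N z = 1 := by
  rw [mul_eq_one_comm]
  set R := rotationMatrix N z with hR
  set κ : ℂ := ((Real.sqrt (1 + ‖z‖ ^ 2) : ℝ) : ℂ) with hκ
  have hκ0 : κ ≠ 0 := sqrt_one_add_norm_sq_ne_zero z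
  set s : Fin (N + 1) → ℂ := fun n => ((Real.sqrt (N.choose n) : ℝ) : ℂ) with hs
  have hrow : ∀ (w : ℂ) (n : Fin (N + 1)), ∑ k, R k n * s k * w ^ (k : ℕ)
      = (κ ^ N)⁻¹ * s n * ((w - z) ^ (n : ℕ) * (1 + star z * w) ^ (N - n)) := by
    intro w n
    rw [← eval_rotatedMonomial, Polynomial.eval_eq_sum_range' (n := N + 1) (Nat.lt_succ_of_le
      (natDegree_rotatedMonomial_le z (Nat.lt_succ_iff.1 n.2))), Finset.sum_range, Finset.mul_sum]
    refine Finset.sum_congr rfl fun k _ => ?_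
    have hk : s k ≠ 0 := sqrt_choose_ne_zero k
    have : R k n = (κ ^ N)⁻¹ * (rotatedMonomial N z n).coeff k * s n / s k := rfl
    rw [this]
    field_simp
  have hstar_s : ∀ n, star (s n) = s n := fun n => Complex.conj_ofReal _
  have hstar_κ : star κ = κ := Complex.conj_ofReal _
  have hker : ∀ w w' : ℂ, ∑ n, (∑ k, R k n * s k * w ^ (k : ℕ)) *
      star (∑ k, R k n * s k * w' ^ (k : ℕ)) = ∑ n, s n * w ^ (n : ℕ) * star (s n * w' ^ (n : ℕ)) := by
    intro w w'
    have hb : ∀ x y : ℂ, ∑ n : Fin (N + 1), (N.choose n : ℂ) * (x ^ (n : ℕ) * y ^ (N - n))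
        = (x + y) ^ N := by
      intro x y
      rw [add_pow, Finset.sum_range]
      exact Finset.sum_congr rfl fun n _ => by ring
    have h1 := hb ((w - z) * star (w' - z)) ((1 + star z * w) * star (1 + star z * w'))
    have h2 := hb (w * star w') 1
    have hid : (w - z) * star (w' - z) + (1 + star z * w) * star (1 + star z * w')
        = (κ * κ) * (w * star w' + 1) := by
      rw [hκ, sqrt_one_add_norm_sq_mul_self]
      simp only [star_sub, star_add, star_mul, star_one, star_star]
      ring
    calc _ = ∑ n : Fin (N + 1), (κ ^ N)⁻¹ * (κ ^ N)⁻¹ * ((N.choose n : ℂ) *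
          (((w - z) * star (w' - z)) ^ (n : ℕ) *
            ((1 + star z * w) * star (1 + star z * w')) ^ (N - n))) := by
          refine Finset.sum_congr rfl fun n _ => ?_
          rw [hrow, hrow, ← sqrt_choose_mul_self n]
          simp only [star_mul, star_inv₀, star_pow, hstar_s, hstar_κ, mul_pow]
          ring
      _ = ∑ n : Fin (N + 1), (N.choose n : ℂ) * ((w * star w') ^ (n : ℕ) * 1 ^ (N - n)) := by
          rw [← Finset.mul_sum, h1, h2, hid, mul_pow, mul_pow]
          field_simp
      _ = _ := by
          refine Finset.sum_congr rfl fun n _ => ?_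
          rw [← sqrt_choose_mul_self n]
          simp only [star_mul, star_pow, hstar_s, mul_pow, one_pow]
          ring
  set D := R * R.conjTranspose - 1 with hD
  have hzero : ∀ w w' : ℂ, ∑ i, (∑ j, D i j * star (s j * w' ^ (j : ℕ))) * s i * w ^ (i : ℕ) = 0 := by
    intro w w'
    have e1 : ∑ i, (∑ j, (R * R.conjTranspose) i j * star (s j * w' ^ (j : ℕ))) * s i * w ^ (i : ℕ)
        = ∑ n, (∑ k, R k n * s k * w ^ (k : ℕ)) * star (∑ k, R k n * s k * w' ^ (k : ℕ)) := by
      simp only [Matrix.mul_apply, Matrix.conjTranspose_apply, star_sum, Finset.sum_mul,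
        Finset.mul_sum]
      rw [Finset.sum_comm]
      conv_lhs => enter [2, j]; rw [Finset.sum_comm]
      rw [Finset.sum_comm]
      refine Finset.sum_congr rfl fun n _ => ?_
      refine Finset.sum_congr rfl fun i _ => Finset.sum_congr rfl fun j _ => ?_
      simp only [star_mul]
      ring
    have e2 : ∑ i, (∑ j, (1 : Matrix (Fin (N + 1)) (Fin (N + 1)) ℂ) i j * star (s j * w' ^ (j : ℕ)))
        * s i * w ^ (i : ℕ) = ∑ n, s n * w ^ (n : ℕ) * star (s n * w' ^ (n : ℕ)) := by
      refine Finset.sum_congr rfl fun i _ => ?_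
      rw [Finset.sum_eq_single i]
      · rw [Matrix.one_apply_eq]; ring
      · intro j _ hj
        rw [Matrix.one_apply_ne hj.symm, zero_mul]
      · simp
    have e3 : ∑ i, (∑ j, D i j * star (s j * w' ^ (j : ℕ))) * s i * w ^ (i : ℕ)
        = ∑ i, (∑ j, (R * R.conjTranspose) i j * star (s j * w' ^ (j : ℕ))) * s i * w ^ (i : ℕ)
        - ∑ i, (∑ j, (1 : Matrix (Fin (N + 1)) (Fin (N + 1)) ℂ) i j * star (s j * w' ^ (j : ℕ)))
        * s i * w ^ (i : ℕ) := by
      simp only [hD, Matrix.sub_apply, sub_mul, Finset.sum_sub_distrib]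
    rw [e3, e1, e2, hker, sub_self]
  rw [← sub_eq_zero]
  change D = 0
  ext i j
  have h1 : ∀ w' : ℂ, ∑ j, D i j * star (s j * w' ^ (j : ℕ)) = 0 := fun w' =>
    congrFun (eq_zero_of_forall_sum_eq_zero (x := fun i => ∑ j, D i j * star (s j * w' ^ (j : ℕ)))
      fun w => hzero w w') i
  have h2 : (fun j => star (D i j)) = 0 := eq_zero_of_forall_sum_eq_zero fun w => by
    have := congrArg star (h1 w)
    rw [star_sum, star_zero] at this
    rw [← this]
    refine Finset.sum_congr rfl fun j _ => ?_
    rw [star_mul, star_star]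
    ring
  simpa using congrFun h2 j

theorem rotationMatrix_zero_zero (N : ℕ) (z : ℂ) :
    rotationMatrix N z 0 0 = (((Real.sqrt (1 + ‖z‖ ^ 2) : ℝ) : ℂ) ^ N)⁻¹ := by
  simp [rotationMatrix, rotatedMonomial, Polynomial.coeff_zero_eq_eval_zero]

theorem norm_sq_rotationMatrix_zero_zero (N : ℕ) (z : ℂ) :
    ‖rotationMatrix N z 0 0‖ ^ 2 = ((1 + ‖z‖ ^ 2) ^ N)⁻¹ := by
  rw [rotationMatrix_zero_zero, norm_inv, norm_pow, Complex.norm_real,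
    Real.norm_of_nonneg (Real.sqrt_nonneg _), inv_pow, ← pow_mul, mul_comm, pow_mul,
    Real.sq_sqrt (by positivity)]

theorem eval_ellipticPoly_rotationMatrix_self {N : ℕ} (z : ℂ) (b : Fin N → ℂ) :
    (ellipticPoly N ((rotationMatrix N z).mulVec (Fin.cons 0 b))).eval z = 0 := by
  rw [ellipticPoly_rotationMatrix_mulVec, Polynomial.eval_finsetSum]
  refine Finset.sum_eq_zero fun n _ => ?_
  refine Fin.cases ?_ (fun i => ?_) n
  · simp
  · simp [eval_rotatedMonomial]

/-- The derivative at a zero moved from `0` to `z`; it depends only on the linear coefficient. -/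
theorem norm_sq_derivative_ellipticPoly_rotationMatrix {M : ℕ} (z : ℂ) (b : Fin (M + 1) → ℂ) :
    ‖(ellipticPoly (M + 1) ((rotationMatrix (M + 1) z).mulVec (Fin.cons 0 b))).derivative.eval z‖ ^ 2
      = (M + 1) * (1 + ‖z‖ ^ 2) ^ (2 * M) / (1 + ‖z‖ ^ 2) ^ (M + 1) * ‖b 0‖ ^ 2 := by
  have h : (ellipticPoly (M + 1) ((rotationMatrix (M + 1) z).mulVec (Fin.cons 0 b))).derivative.eval z
      = (((Real.sqrt (1 + ‖z‖ ^ 2) : ℝ) : ℂ) ^ (M + 1))⁻¹ *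
        (b 0 * ((Real.sqrt ((M + 1 : ℕ) : ℝ) : ℝ) : ℂ)) * (1 + star z * z) ^ M := by
    rw [ellipticPoly_rotationMatrix_mulVec, Polynomial.derivative_sum, Polynomial.eval_finsetSum,
      Fin.sum_univ_succ, Fin.sum_univ_succ, Finset.sum_eq_zero]
    · simp [rotatedMonomial, Polynomial.derivative_mul, Polynomial.derivative_pow]
    · intro i _
      simp [rotatedMonomial, Polynomial.derivative_mul, Polynomial.derivative_pow]
  have hz : (1 + star z * z : ℂ) = ((1 + ‖z‖ ^ 2 : ℝ) : ℂ) := by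
    rw [mul_comm, RCLike.star_def, Complex.mul_conj, Complex.normSq_eq_norm_sq]
    simp
  have hn : ‖(((Real.sqrt (1 + ‖z‖ ^ 2) : ℝ) : ℂ) ^ (M + 1))⁻¹‖ ^ 2 = ((1 + ‖z‖ ^ 2) ^ (M + 1))⁻¹ := by
    rw [← rotationMatrix_zero_zero, norm_sq_rotationMatrix_zero_zero]
  rw [h, hz, norm_mul, norm_mul, norm_mul, mul_pow, mul_pow, mul_pow, hn, norm_pow, Complex.norm_real,
    Complex.norm_real, Real.norm_of_nonneg (Real.sqrt_nonneg _), Real.sq_sqrt (Nat.cast_nonneg _),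
    Real.norm_of_nonneg (by positivity)]
  push_cast
  ring

/-- The rotation moves the roots by the Möbius map sending `0` to `z`, with multiplicities. -/
theorem rootSum_rotationMatrix {N : ℕ} {z : ℂ} {b : Fin (N + 1) → ℂ} (hb : b (Fin.last N) ≠ 0)
    (ha : (rotationMatrix N z).mulVec b (Fin.last N) ≠ 0) {φ ψ : ℂ → ℝ≥0∞}
    (hφ : ∀ ζ, 1 - star z * ζ ≠ 0 → φ ((ζ + z) / (1 - star z * ζ)) = ψ ζ) :
    rootSum φ ((rotationMatrix N z).mulVec b) = rootSum ψ b := by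
  obtain ⟨ζ, hζr, hζ⟩ := exists_roots_ellipticPoly hb
  set κ : ℂ := ((Real.sqrt (1 + ‖z‖ ^ 2) : ℝ) : ℂ) with hκ
  have hκ0 : κ ≠ 0 := sqrt_one_add_norm_sq_ne_zero z
  set a := (rotationMatrix N z).mulVec b with hadef
  -- The factorization is needed in homogeneous form, since `1 + conj z * w` may vanish.
  have hhom : ∀ x y : ℂ, ∑ n : Fin (N + 1), b n * ((Real.sqrt (N.choose n) : ℝ) : ℂ) *
      (x ^ (n : ℕ) * y ^ (N - n)) = b (Fin.last N) * ∏ i, (x - ζ i * y) := by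
    intro x y
    by_cases hy : y = 0
    · rw [Finset.sum_eq_single (Fin.last N)]
      · simp [hy]
      · intro n _ hn
        have : N - (n : ℕ) ≠ 0 := by
          have := n.2
          have : (n : ℕ) ≠ N := fun h => hn (Fin.ext h)
          omega
        simp [hy, this]
      · simp
    · have h := congrArg (Polynomial.eval (x / y)) hζ
      rw [eval_ellipticPoly] at h
      simp only [Polynomial.eval_mul, Polynomial.eval_C, Polynomial.eval_prod, Polynomial.eval_sub,
        Polynomial.eval_X] at h
      have e1 : ∏ i, (x - ζ i * y) = y ^ N * ∏ i, (x / y - ζ i) := by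
        rw [show y ^ N = ∏ _i : Fin N, y by simp, ← Finset.prod_mul_distrib]
        refine Finset.prod_congr rfl fun i _ => ?_
        field_simp
      rw [e1, mul_left_comm, ← h, Finset.mul_sum]
      refine Finset.sum_congr rfl fun n _ => ?_
      have : y ^ N = y ^ (N - (n : ℕ)) * y ^ (n : ℕ) := by
        rw [← pow_add, Nat.sub_add_cancel (Nat.lt_succ_iff.1 n.2)]
      rw [this, div_pow]
      field_simp
  have hfac : ellipticPoly N a = Polynomial.C ((κ ^ N)⁻¹ * b (Fin.last N)) *
      ∏ i, (Polynomial.C (1 - star z * ζ i) * Polynomial.X + Polynomial.C (-(ζ i + z))) := by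
    refine Polynomial.funext fun w => ?_
    rw [hadef, ellipticPoly_rotationMatrix_mulVec, Polynomial.eval_finsetSum]
    simp only [Polynomial.eval_mul, Polynomial.eval_C, eval_rotatedMonomial, Polynomial.eval_prod,
      Polynomial.eval_add, Polynomial.eval_X]
    have h := hhom (w - z) (1 + star z * w)
    rw [show ∏ i, ((1 - star z * ζ i) * w + -(ζ i + z)) = ∏ i, (w - z - ζ i * (1 + star z * w)) from
      Finset.prod_congr rfl fun i _ => by ring, mul_assoc, ← h, Finset.mul_sum]
    exact Finset.sum_congr rfl fun n _ => by ring
  have hne : ∀ i, 1 - star z * ζ i ≠ 0 := by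
    -- The top coefficient is a multiple of the product of these numbers: no root is sent to infinity.
    have hc : (ellipticPoly N a).coeff N = (κ ^ N)⁻¹ * b (Fin.last N) * ∏ i, (1 - star z * ζ i) := by
      rw [hfac, Polynomial.coeff_C_mul]
      have := Polynomial.coeff_prod_of_natDegree_le (s := (Finset.univ : Finset (Fin N)))
        (fun i => Polynomial.C (1 - star z * ζ i) * Polynomial.X + Polynomial.C (-(ζ i + z))) 1
        fun i _ => Polynomial.natDegree_linear_le
      rw [Finset.card_univ, Fintype.card_fin, mul_one] at this
      rw [this]
      simp
    have hc' := coeff_ellipticPoly a (Fin.last N)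
    rw [Fin.val_last, hc] at hc'
    have hr : a (Fin.last N) * ((Real.sqrt (N.choose N) : ℝ) : ℂ) ≠ 0 :=
      mul_ne_zero ha (by simp)
    rw [← hc'] at hr
    exact fun i => Finset.prod_ne_zero_iff.1 (right_ne_zero_of_mul hr) i (Finset.mem_univ i)
  have hroots : (ellipticPoly N a).roots = (Finset.univ : Finset (Fin N)).val.map
      fun i => (ζ i + z) / (1 - star z * ζ i) := by
    rw [hfac, Polynomial.roots_C_mul _ (mul_ne_zero (inv_ne_zero (pow_ne_zero _ hκ0)) hb),
      Polynomial.roots_prod]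
    · rw [Multiset.bind_congr (g := fun i => {(ζ i + z) / (1 - star z * ζ i)}), 
        Multiset.bind_singleton]
      intro i _
      rw [Polynomial.roots_C_mul_X_add_C _ (hne i)]
      congr 1
      field_simp
    · refine Finset.prod_ne_zero_iff.2 fun i _ h => hne i ?_
      have := congrArg (fun p => Polynomial.coeff p 1) h
      simpa using this
  rw [rootSum, rootSum, if_neg ha, if_neg hb, hroots, ← hζr, Multiset.map_map, Multiset.map_map]
  congr 1
  refine Multiset.map_congr rfl fun i _ => hφ _ (hne i)

/-- The chordal distance in stereographic coordinates. -/
theorem dist_stereoInv_sq (w z : ℂ) :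
    dist (stereoInv w) (stereoInv z) ^ 2 = 4 * ‖w - z‖ ^ 2 / ((1 + ‖w‖ ^ 2) * (1 + ‖z‖ ^ 2)) := by
  have hw : ‖w‖ ^ 2 = w.re ^ 2 + w.im ^ 2 := by
    rw [Complex.sq_norm, Complex.normSq_apply]; ring
  have hz : ‖z‖ ^ 2 = z.re ^ 2 + z.im ^ 2 := by
    rw [Complex.sq_norm, Complex.normSq_apply]; ring
  have hwz : ‖w - z‖ ^ 2 = (w.re - z.re) ^ 2 + (w.im - z.im) ^ 2 := by
    rw [Complex.sq_norm, Complex.normSq_apply, Complex.sub_re, Complex.sub_im]; ring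
  have h1 : (1 + ‖w‖ ^ 2 : ℝ) ≠ 0 := by positivity
  have h2 : (1 + ‖z‖ ^ 2 : ℝ) ≠ 0 := by positivity
  rw [Subtype.dist_eq, EuclideanSpace.dist_eq, Real.sq_sqrt (by positivity)]
  simp only [stereoInv, Fin.sum_univ_three, Real.dist_eq, sq_abs]
  simp only [Matrix.cons_val]
  rw [hwz]
  rw [hw] at h1 ⊢
  rw [hz] at h2 ⊢
  field_simp
  ring

theorem dist_stereoInv_rotation {z ζ : ℂ} (h : 1 - star z * ζ ≠ 0) :
    dist (stereoInv ((ζ + z) / (1 - star z * ζ))) (stereoInv z)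
      = dist (stereoInv ζ) (stereoInv 0) := by
  rw [← sq_eq_sq₀ dist_nonneg dist_nonneg, dist_stereoInv_sq, dist_stereoInv_sq]
  have hd : (‖1 - star z * ζ‖ ^ 2 : ℝ) ≠ 0 := pow_ne_zero _ (norm_ne_zero_iff.2 h)
  have hpar : ‖1 - star z * ζ‖ ^ 2 + ‖ζ + z‖ ^ 2 = (1 + ‖ζ‖ ^ 2) * (1 + ‖z‖ ^ 2) := by
    simp only [Complex.sq_norm, Complex.normSq_apply, Complex.sub_re, Complex.sub_im,
      Complex.add_re, Complex.add_im, Complex.mul_re, Complex.mul_im, Complex.one_re,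
      Complex.one_im, RCLike.star_def, Complex.conj_re, Complex.conj_im]
    ring
  have hsub : (ζ + z) / (1 - star z * ζ) - z = ζ * (1 + z * star z) / (1 - star z * ζ) := by
    rw [div_sub' h]
    congr 1
    ring
  have hz : ‖1 + z * star z‖ = 1 + ‖z‖ ^ 2 := by
    rw [RCLike.star_def, Complex.mul_conj, Complex.normSq_eq_norm_sq, ← Complex.ofReal_one,
      ← Complex.ofReal_add, Complex.norm_real, Real.norm_of_nonneg (by positivity)]
  have hden : 1 + ‖(ζ + z) / (1 - star z * ζ)‖ ^ 2
      = (1 + ‖ζ‖ ^ 2) * (1 + ‖z‖ ^ 2) / ‖1 - star z * ζ‖ ^ 2 := by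
    rw [← hpar, norm_div, div_pow, add_div, div_self hd]
  rw [hden, hsub, norm_div, norm_mul, hz, div_pow, mul_pow]
  have h1 : (1 + ‖ζ‖ ^ 2 : ℝ) ≠ 0 := by positivity
  have h2 : (1 + ‖z‖ ^ 2 : ℝ) ≠ 0 := by positivity
  simp only [sub_zero, norm_zero]
  field_simp
  ring

/-! ### Reduction to a zero at the origin -/

theorem gaussianVector_absolutelyContinuous (n : ℕ) :
    gaussianVector n ≪ (volume : Measure (Fin n → ℂ)) := by
  refine Measure.AbsolutelyContinuous.mk fun s hs h0 => ?_
  rw [← lintegral_indicator_one hs, lintegral_gaussianVector _ (measurable_one.indicator hs)]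
  refine (lintegral_eq_zero_iff ?_).2 ?_
  · exact Measurable.mul (by fun_prop) (measurable_one.indicator hs)
  · filter_upwards [measure_eq_zero_iff_ae_notMem.1 h0] with x hx
    simp [hx]

theorem ae_gaussianVector_linear_form_ne_zero {n : ℕ} {c : Fin n → ℂ} {j : Fin n} (hc : c j ≠ 0) :
    ∀ᵐ b ∂(gaussianVector n), ∑ i, c i * b i ≠ 0 := by
  refine (gaussianVector_absolutelyContinuous n).ae_le ?_
  set L : (Fin n → ℂ) →ₗ[ℂ] ℂ := Fintype.linearCombination ℂ c with hL
  set K : Submodule ℝ (Fin n → ℂ) := (LinearMap.ker L).restrictScalars ℝ with hK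
  have hmem : ∀ b, b ∈ K ↔ ∑ i, c i * b i = 0 := by
    intro b
    simp [hK, hL, Fintype.linearCombination_apply, mul_comm]
  have hne : K ≠ ⊤ := by
    intro h
    have : Pi.single j (1 : ℂ) ∈ K := by rw [h]; trivial
    rw [hmem, Finset.sum_eq_single j] at this
    · exact hc (by simpa using this)
    · intro i _ hi
      simp [Pi.single_eq_of_ne hi]
    · simp
  have h0 := Measure.addHaar_submodule volume K hne
  filter_upwards [measure_eq_zero_iff_ae_notMem.1 h0] with b hb h
  exact hb ((hmem b).2 h)

theorem ae_gaussianVector_apply_ne_zero {n : ℕ} (j : Fin n) :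
    ∀ᵐ b ∂(gaussianVector n), b j ≠ 0 := by
  have := ae_gaussianVector_linear_form_ne_zero (c := Pi.single j 1) (j := j) (by simp)
  filter_upwards [this] with b hb
  rw [Finset.sum_eq_single j] at hb
  · simpa using hb
  · intro i _ hi
    simp [Pi.single_eq_of_ne hi]
  · simp

/-- The `0`-`1` indicator that the points over `w` and `z` are at chordal distance at most `t`. -/
noncomputable def closeIndicator (t : ℝ) (z w : ℂ) : ℝ≥0∞ :=
  {w | dist (stereoInv w) (stereoInv z) ≤ t}.indicator 1 w

theorem measurable_closeIndicator (t : ℝ) : Measurable (Function.uncurry (closeIndicator t)) := by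
  have hd : ∀ w z, dist (stereoInv w) (stereoInv z)
      = Real.sqrt (4 * ‖w - z‖ ^ 2 / ((1 + ‖w‖ ^ 2) * (1 + ‖z‖ ^ 2))) := by
    intro w z
    rw [← dist_stereoInv_sq, Real.sqrt_sq dist_nonneg]
  have hs : MeasurableSet {p : ℂ × ℂ | dist (stereoInv p.2) (stereoInv p.1) ≤ t} := by
    simp only [hd]
    exact measurableSet_le (by fun_prop) measurable_const
  exact measurable_one.indicator hs

/-- The number of ordered pairs of roots, each root being also paired with itself, whose points on
the sphere are at chordal distance at most `t`. -/
noncomputable def closePairSum {N : ℕ} (t : ℝ) (a : Fin (N + 1) → ℂ) : ℝ≥0∞ :=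
  rootSum (fun z => rootSum (closeIndicator t z) a) a

theorem measurable_rootSum_closeIndicator {N : ℕ} (t : ℝ) :
    Measurable fun p : ℂ × (Fin (N + 1) → ℂ) => rootSum (closeIndicator t p.1) p.2 :=
  measurable_rootSum _ (measurable_closeIndicator t)

theorem measurable_closePairSum {N : ℕ} (t : ℝ) :
    Measurable (closePairSum t : (Fin (N + 1) → ℂ) → ℝ≥0∞) := by
  have h0 : Measurable (Function.uncurry fun (a : Fin (N + 1) → ℂ) (z : ℂ) =>
      rootSum (closeIndicator t z) a) := by
    simp only [Function.uncurry_def]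
    exact (measurable_rootSum_closeIndicator t).comp (measurable_snd.prodMk measurable_fst)
  have h := measurable_rootSum (N := N) (Y := Fin (N + 1) → ℂ) _ h0
  have h1 : Measurable fun a : Fin (N + 1) → ℂ => (a, a) := measurable_id.prodMk measurable_id
  exact h.comp h1

theorem ellipticPoly_finCons {N : ℕ} (c : ℂ) (y : Fin N → ℂ) :
    ellipticPoly N (Fin.cons c y) = Polynomial.C c + ellipticPoly N (Fin.cons 0 y) := by
  simp [ellipticPoly, Fin.sum_univ_succ, Polynomial.monomial_zero_left]

theorem derivative_ellipticPoly_finCons {N : ℕ} (c : ℂ) (y : Fin N → ℂ) :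
    (ellipticPoly N (Fin.cons c y)).derivative = (ellipticPoly N (Fin.cons 0 y)).derivative := by
  rw [ellipticPoly_finCons]
  simp

theorem measurable_eval_ellipticPoly {N : ℕ} :
    Measurable fun p : (Fin (N + 1) → ℂ) × ℂ => (ellipticPoly N p.1).eval p.2 := by
  simp only [eval_ellipticPoly]
  fun_prop

theorem measurable_eval_derivative_ellipticPoly {N : ℕ} :
    Measurable fun p : (Fin (N + 1) → ℂ) × ℂ => (ellipticPoly N p.1).derivative.eval p.2 := by
  simp only [ellipticPoly, Polynomial.derivative_sum, Polynomial.derivative_monomial,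
    Polynomial.eval_finsetSum, Polynomial.eval_monomial]
  fun_prop

/-- Minus the nonconstant part of the elliptic polynomial: the roots of the polynomial with constant
coefficient `c` are the preimages of `c` under it. -/
noncomputable def graphPoly {N : ℕ} (y : Fin N → ℂ) : Polynomial ℂ :=
  -ellipticPoly N (Fin.cons 0 y)

theorem roots_ellipticPoly_finCons {N : ℕ} (c : ℂ) (y : Fin N → ℂ) :
    (ellipticPoly N (Fin.cons c y)).roots = (graphPoly y - Polynomial.C c).roots := by
  rw [ellipticPoly_finCons, ← Polynomial.roots_neg, graphPoly]
  congr 1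
  ring

theorem measurable_finCons_zero {n : ℕ} :
    Measurable fun y : Fin n → ℂ => (Fin.cons 0 y : Fin (n + 1) → ℂ) :=
  measurable_finCons.comp (measurable_const.prodMk measurable_id)

theorem measurable_eval_graphPoly {N : ℕ} :
    Measurable fun p : (Fin N → ℂ) × ℂ => (graphPoly p.1).eval p.2 := by
  simp only [graphPoly, Polynomial.eval_neg]
  exact (measurable_eval_ellipticPoly.comp
    ((measurable_finCons_zero.comp measurable_fst).prodMk measurable_snd)).neg

/-- The area formula for the constant coefficient, all other coefficients being fixed. The root sum in
`closePairSum` runs over the preimages of `c` under `graphPoly y`. -/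
theorem lintegral_closePairSum_finCons {M : ℕ} (t : ℝ) (y : Fin (M + 1) → ℂ) :
    ∫⁻ c, closePairSum t (Fin.cons c y : Fin (M + 1 + 1) → ℂ) ∂stdComplexGaussian
      = ∫⁻ z, ENNReal.ofReal (‖(graphPoly y).derivative.eval z‖ ^ 2) *
        (ENNReal.ofReal (Real.exp (-‖(graphPoly y).eval z‖ ^ 2) / Real.pi) *
          rootSum (closeIndicator t z) (Fin.cons ((graphPoly y).eval z) y)) := by
  have hcm : Measurable fun c : ℂ => (Fin.cons c y : Fin (M + 1 + 1) → ℂ) :=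
    measurable_finCons.comp (measurable_id.prodMk measurable_const)
  have hg := (graphPoly y).continuous.measurable
  have hΦ : Measurable fun z : ℂ => rootSum (closeIndicator t z)
      (Fin.cons ((graphPoly y).eval z) y : Fin (M + 1 + 1) → ℂ) :=
    (measurable_rootSum_closeIndicator t).comp (measurable_id.prodMk (hcm.comp hg))
  rw [lintegral_stdComplexGaussian (fun c => closePairSum t (Fin.cons c y))
    ((measurable_closePairSum t).comp hcm),
    ← lintegral_sum_roots_sub_C _ _ (by fun_prop)]
  have hlast : ∀ c : ℂ, (Fin.cons c y : Fin (M + 1 + 1) → ℂ) (Fin.last (M + 1)) = y (Fin.last M) :=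
    fun c => by rw [← Fin.succ_last, Fin.cons_succ]
  refine lintegral_congr fun c => ?_
  by_cases h0 : y (Fin.last M) = 0
  · have : ∀ (c : ℂ) (φ : ℂ → ℝ≥0∞), rootSum φ (Fin.cons c y : Fin (M + 1 + 1) → ℂ) = 0 :=
      fun c φ => by rw [rootSum, if_pos (by rw [hlast, h0])]
    simp [closePairSum, this]
  · rw [closePairSum, rootSum, if_neg (by rwa [hlast]), roots_ellipticPoly_finCons,
      ← Multiset.sum_map_mul_left]
    congr 1
    refine Multiset.map_congr rfl fun z hz => ?_
    have hz' : (graphPoly y).eval z = c := by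
      have := Polynomial.isRoot_of_mem_roots hz
      rwa [Polynomial.IsRoot.def, Polynomial.eval_sub, Polynomial.eval_C, sub_eq_zero] at this
    rw [hz']

theorem rotationMatrix_last_last_ne_zero (N : ℕ) (z : ℂ) :
    rotationMatrix N z (Fin.last N) (Fin.last N) ≠ 0 := by
  have h : (rotatedMonomial N z N).coeff N = 1 := by
    have hm := (Polynomial.monic_X_sub_C z).pow N
    have := hm.coeff_natDegree
    rw [(Polynomial.monic_X_sub_C z).natDegree_pow, Polynomial.natDegree_X_sub_C, mul_one] at this
    simpa [rotatedMonomial] using this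
  have h1 : Real.sqrt (1 + ‖z‖ ^ 2) ≠ 0 := by exact_mod_cast sqrt_one_add_norm_sq_ne_zero z
  simp [rotationMatrix, h, h1]

/-- For fixed `z`, the integral over the polynomials vanishing at `z` is rotated to `0`. -/
theorem lintegral_graph_eq_lintegral_at_zero {M : ℕ} (t : ℝ) (z : ℂ) :
    ∫⁻ y : Fin (M + 1) → ℂ, ENNReal.ofReal (‖(graphPoly y).derivative.eval z‖ ^ 2) *
        (ENNReal.ofReal (Real.exp (-‖(graphPoly y).eval z‖ ^ 2) / Real.pi) *
          rootSum (closeIndicator t z) (Fin.cons ((graphPoly y).eval z) y)) ∂(gaussianVector (M + 1))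
      = ENNReal.ofReal ((M + 1) / Real.pi * ((1 + ‖z‖ ^ 2) ^ 2)⁻¹) *
        ∫⁻ b : Fin (M + 1) → ℂ, ENNReal.ofReal (‖b 0‖ ^ 2) *
          rootSum (closeIndicator t 0) (Fin.cons 0 b) ∂(gaussianVector (M + 1)) := by
  set U := rotationMatrix (M + 1) z with hU
  have hUU := conjTranspose_mul_rotationMatrix (M + 1) z
  have hU0 : U 0 0 ≠ 0 := by
    rw [hU, rotationMatrix_zero_zero]
    exact inv_ne_zero (pow_ne_zero _ (sqrt_one_add_norm_sq_ne_zero z))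
  have hUh : ∀ b : Fin (M + 1) → ℂ, U.mulVec (Fin.cons 0 b) 0 =
      (fun y : Fin (M + 1) → ℂ => (graphPoly y).eval z) fun i => U.mulVec (Fin.cons 0 b) i.succ := by
    intro b
    have h := eval_ellipticPoly_rotationMatrix_self z b
    rw [← hU, ← Fin.cons_self_tail (U.mulVec (Fin.cons 0 b)), ellipticPoly_finCons,
      Polynomial.eval_add, Polynomial.eval_C] at h
    simp only [graphPoly, Polynomial.eval_neg]
    exact eq_neg_of_add_eq_zero_left h
  have hhm : Measurable fun y : Fin (M + 1) → ℂ => (graphPoly y).eval z :=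
    measurable_eval_graphPoly.comp (measurable_id.prodMk measurable_const)
  have hdm : Measurable fun a : Fin (M + 1 + 1) → ℂ => (ellipticPoly (M + 1) a).derivative.eval z :=
    measurable_eval_derivative_ellipticPoly.comp (measurable_id.prodMk measurable_const)
  have hΦ : Measurable fun a : Fin (M + 1 + 1) → ℂ => rootSum (closeIndicator t z) a :=
    (measurable_rootSum_closeIndicator t).comp (measurable_const.prodMk measurable_id)
  have hyp := lintegral_gaussianVector_hyperplane hUU hU0 _ hhm hUh
    (fun a => ENNReal.ofReal (1 / Real.pi) *
      (ENNReal.ofReal (‖(ellipticPoly (M + 1) a).derivative.eval z‖ ^ 2) *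
        rootSum (closeIndicator t z) a)) (by fun_prop)
  have hlhs : ∀ y : Fin (M + 1) → ℂ, ENNReal.ofReal (‖(graphPoly y).derivative.eval z‖ ^ 2) *
        (ENNReal.ofReal (Real.exp (-‖(graphPoly y).eval z‖ ^ 2) / Real.pi) *
          rootSum (closeIndicator t z) (Fin.cons ((graphPoly y).eval z) y))
      = ENNReal.ofReal (Real.exp (-‖(graphPoly y).eval z‖ ^ 2)) * (ENNReal.ofReal (1 / Real.pi) *
      (ENNReal.ofReal (‖(ellipticPoly (M + 1)
          (Fin.cons ((graphPoly y).eval z) y)).derivative.eval z‖ ^ 2) *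
        rootSum (closeIndicator t z) (Fin.cons ((graphPoly y).eval z) y))) := by
    intro y
    have hder : ‖(ellipticPoly (M + 1) (Fin.cons ((graphPoly y).eval z) y)).derivative.eval z‖
        = ‖(graphPoly y).derivative.eval z‖ := by
      rw [derivative_ellipticPoly_finCons, graphPoly]
      simp
    rw [hder, div_eq_mul_one_div, ENNReal.ofReal_mul (Real.exp_nonneg _)]
    ring
  rw [lintegral_congr hlhs, hyp, ← lintegral_const_mul', ← lintegral_const_mul']
  · have hae1 : ∀ᵐ b ∂(gaussianVector (M + 1)), b (Fin.last M) ≠ 0 :=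
      ae_gaussianVector_apply_ne_zero _
    have hae2 : ∀ᵐ b ∂(gaussianVector (M + 1)),
        ∑ i : Fin (M + 1), U (Fin.last (M + 1)) i.succ * b i ≠ 0 :=
      ae_gaussianVector_linear_form_ne_zero (j := Fin.last M)
        (by rw [Fin.succ_last]; exact rotationMatrix_last_last_ne_zero _ _)
    refine lintegral_congr_ae ?_
    filter_upwards [hae1, hae2] with b hb1 hb2
    have hrs : rootSum (closeIndicator t z) (U.mulVec (Fin.cons 0 b))
        = rootSum (closeIndicator t 0) (Fin.cons 0 b : Fin (M + 1 + 1) → ℂ) := by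
      refine rootSum_rotationMatrix ?_ ?_ fun ζ hζ => ?_
      · rwa [← Fin.succ_last, Fin.cons_succ]
      · rw [← hU, Matrix.mulVec, dotProduct, Fin.sum_univ_succ]
        simpa using hb2
      · simp only [closeIndicator, Set.indicator_apply, Set.mem_ofPred_eq,
          dist_stereoInv_rotation hζ, Pi.one_apply]
    rw [hrs, norm_sq_derivative_ellipticPoly_rotationMatrix, norm_sq_rotationMatrix_zero_zero,
      ← mul_assoc, ← mul_assoc, ← mul_assoc]
    congr 1
    have hp := Real.pi_pos
    rw [← ENNReal.ofReal_mul (by positivity), ← ENNReal.ofReal_mul (by positivity),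
      ← ENNReal.ofReal_mul (by positivity)]
    congr 1
    have h1 : (1 + ‖z‖ ^ 2 : ℝ) ≠ 0 := by positivity
    field_simp
    ring
  · exact ENNReal.ofReal_ne_top
  · exact ENNReal.ofReal_ne_top

/-- The uniform probability density on the sphere, in stereographic coordinates. -/
theorem lintegral_sphere_density :
    ∫⁻ z : ℂ, ENNReal.ofReal (1 / Real.pi * ((1 + ‖z‖ ^ 2) ^ 2)⁻¹) = 1 := by
  have hd : ∀ u ∈ Set.Ioi (0 : ℝ), HasDerivAt (fun u : ℝ => -(1 + u)⁻¹) ((1 + u) ^ 2)⁻¹ u := by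
    intro u hu
    have hu0 : (1 + u : ℝ) ≠ 0 := by
      have : (0 : ℝ) < u := hu
      positivity
    exact (((hasDerivAt_id' u).const_add 1).fun_inv hu0).fun_neg.congr_deriv
      (by simp [neg_div])
  have hc : ContinuousWithinAt (fun u : ℝ => -(1 + u)⁻¹) (Set.Ici 0) 0 := by
    refine ContinuousAt.continuousWithinAt ?_
    refine ContinuousAt.neg (ContinuousAt.inv₀ (by fun_prop) (by norm_num))
  have hpos : ∀ u ∈ Set.Ioi (0 : ℝ), 0 ≤ ((1 + u) ^ 2)⁻¹ := fun u _ => by positivity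
  have hlim : Tendsto (fun u : ℝ => -(1 + u)⁻¹) atTop (nhds 0) := by
    have := (tendsto_inv_atTop_zero.comp (tendsto_atTop_add_const_left atTop (1 : ℝ) tendsto_id)).neg
    simpa using this
  have hint := integrableOn_Ioi_deriv_of_nonneg hc hd hpos hlim
  have hval := integral_Ioi_of_hasDerivAt_of_nonneg hc hd hpos hlim
  have hlin : ∫⁻ u in Set.Ioi (0 : ℝ), ENNReal.ofReal ((1 + u) ^ 2)⁻¹ = 1 := by
    rw [← ofReal_integral_eq_lintegral_ofReal hint
      ((ae_restrict_iff' measurableSet_Ioi).2 (ae_of_all _ hpos)), hval]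
    simp
  have hp := Real.pi_pos
  rw [lintegral_comp_norm_sq (fun u => ENNReal.ofReal (1 / Real.pi * ((1 + u) ^ 2)⁻¹)) (by fun_prop)]
  simp_rw [ENNReal.ofReal_mul (show 0 ≤ 1 / Real.pi by positivity)]
  rw [lintegral_const_mul _ (by fun_prop), hlin, mul_one, ← ENNReal.ofReal_mul hp.le,
    mul_one_div_cancel hp.ne', ENNReal.ofReal_one]

/-- Rotation invariance reduces the expected number of close pairs to the Palm measure at `0`. -/
theorem lintegral_closePairSum {M : ℕ} (t : ℝ) :
    ∫⁻ a : Fin (M + 1 + 1) → ℂ, closePairSum t a ∂(gaussianVector (M + 1 + 1))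
      = (M + 1) * ∫⁻ b : Fin (M + 1) → ℂ, ENNReal.ofReal (‖b 0‖ ^ 2) *
          rootSum (closeIndicator t 0) (Fin.cons 0 b) ∂(gaussianVector (M + 1)) := by
  rw [lintegral_pi_finCons _ _ (measurable_closePairSum t)]
  simp_rw [lintegral_closePairSum_finCons]
  have hg := measurable_eval_graphPoly (N := M + 1)
  have hd : Measurable fun p : (Fin (M + 1) → ℂ) × ℂ => (graphPoly p.1).derivative.eval p.2 := by
    simp only [graphPoly, Polynomial.derivative_neg, Polynomial.eval_neg]
    exact (measurable_eval_derivative_ellipticPoly.comp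
      ((measurable_finCons_zero.comp measurable_fst).prodMk measurable_snd)).neg
  have hΦ : Measurable fun p : (Fin (M + 1) → ℂ) × ℂ => rootSum (closeIndicator t p.2)
      (Fin.cons ((graphPoly p.1).eval p.2) p.1 : Fin (M + 1 + 1) → ℂ) :=
    (measurable_rootSum_closeIndicator t).comp
      (measurable_snd.prodMk (measurable_finCons.comp (hg.prodMk measurable_fst)))
  rw [lintegral_lintegral_swap (by
    refine Measurable.aemeasurable ?_
    simp only [Function.uncurry_def]
    fun_prop)]
  simp_rw [lintegral_graph_eq_lintegral_at_zero]
  rw [lintegral_mul_const _ (by fun_prop)]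
  congr 1
  have : ∀ z : ℂ, ENNReal.ofReal ((M + 1) / Real.pi * ((1 + ‖z‖ ^ 2) ^ 2)⁻¹)
      = (M + 1) * ENNReal.ofReal (1 / Real.pi * ((1 + ‖z‖ ^ 2) ^ 2)⁻¹) := by
    intro z
    rw [show ((M : ℝ) + 1) / Real.pi * ((1 + ‖z‖ ^ 2) ^ 2)⁻¹
      = ((M + 1 : ℕ) : ℝ) * (1 / Real.pi * ((1 + ‖z‖ ^ 2) ^ 2)⁻¹) by push_cast; ring,
      ENNReal.ofReal_mul (Nat.cast_nonneg _), ENNReal.ofReal_natCast]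
    push_cast
    rfl
  simp_rw [this]
  rw [lintegral_const_mul _ (by fun_prop), lintegral_sphere_density, mul_one]

/-! ### The Palm measure at the origin -/

/-- The nonconstant part of the normalized variance polynomial
`((1 + u) ^ (M + 1) - 1) / ((M + 1) * u)`. -/
noncomputable def varTail (M : ℕ) (u : ℝ) : ℝ :=
  ∑ i : Fin M, ((M + 1).choose (i + 2) : ℝ) / (M + 1) * u ^ (i + 1 : ℕ)

/-- The derivative of `varTail`. -/
noncomputable def varTailDeriv (M : ℕ) (u : ℝ) : ℝ :=
  ∑ i : Fin M, (i + 1) * (((M + 1).choose (i + 2) : ℝ) / (M + 1)) * u ^ (i : ℕ)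

/-- The derivative of `u * varTailDeriv M u` (not of `varTailDeriv` itself). -/
noncomputable def varTailDeriv₂ (M : ℕ) (u : ℝ) : ℝ :=
  ∑ i : Fin M, (i + 1) ^ 2 * (((M + 1).choose (i + 2) : ℝ) / (M + 1)) * u ^ (i : ℕ)

/-- The density, in `u = ‖w‖ ^ 2`, of further zeros at `w` under the Palm measure at `0`; the factor
`1 + varTail M u` is the normalized variance. -/
noncomputable def palmDensity (M : ℕ) (u : ℝ) : ℝ :=
  2 * (u * varTailDeriv M u ^ 2) / (1 + varTail M u) ^ 3 +
    (varTail M u * varTailDeriv₂ M u - u * varTailDeriv M u ^ 2) / (1 + varTail M u) ^ 2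

/-- The expected number of further zeros in `‖w‖ ^ 2 ≤ u` under the Palm measure at `0`, an explicit
primitive of `palmDensity`. -/
noncomputable def palmCount (M : ℕ) (u : ℝ) : ℝ :=
  u * varTailDeriv M u * varTail M u / (1 + varTail M u) ^ 2

theorem varTail_nonneg (M : ℕ) {u : ℝ} (hu : 0 ≤ u) : 0 ≤ varTail M u :=
  Finset.sum_nonneg fun i _ => by positivity

theorem hasDerivAt_varTail (M : ℕ) (u : ℝ) : HasDerivAt (varTail M) (varTailDeriv M u) u := by
  have h : ∀ i ∈ (Finset.univ : Finset (Fin M)), HasDerivAt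
      (fun u : ℝ => ((M + 1).choose (i + 2) : ℝ) / (M + 1) * u ^ (i + 1 : ℕ))
      ((i + 1) * (((M + 1).choose (i + 2) : ℝ) / (M + 1)) * u ^ (i : ℕ)) u := fun i _ =>
    ((hasDerivAt_pow (i + 1 : ℕ) u).const_mul _).congr_deriv (by push_cast; ring)
  exact HasDerivAt.fun_sum h

theorem hasDerivAt_mul_varTailDeriv (M : ℕ) (u : ℝ) :
    HasDerivAt (fun u => u * varTailDeriv M u) (varTailDeriv₂ M u) u := by
  have h : ∀ i ∈ (Finset.univ : Finset (Fin M)), HasDerivAt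
      (fun u : ℝ => (i + 1) * (((M + 1).choose (i + 2) : ℝ) / (M + 1)) * u ^ (i + 1 : ℕ))
      ((i + 1) ^ 2 * (((M + 1).choose (i + 2) : ℝ) / (M + 1)) * u ^ (i : ℕ)) u := fun i _ =>
    ((hasDerivAt_pow (i + 1 : ℕ) u).const_mul _).congr_deriv (by push_cast; ring)
  have hs := HasDerivAt.fun_sum h
  refine hs.congr_of_eventuallyEq (Eventually.of_forall fun v => ?_)
  simp only [varTailDeriv, Finset.mul_sum]
  exact Finset.sum_congr rfl fun i _ => by ring

theorem hasDerivAt_palmCount (M : ℕ) {u : ℝ} (hu : 0 ≤ u) :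
    HasDerivAt (palmCount M) (palmDensity M u) u := by
  have h0 : 1 + varTail M u ≠ 0 := by
    have := varTail_nonneg M hu
    positivity
  have h := ((hasDerivAt_mul_varTailDeriv M u).mul (hasDerivAt_varTail M u)).fun_div
    (((hasDerivAt_varTail M u).const_add 1).fun_pow 2) (pow_ne_zero 2 h0)
  refine h.congr_deriv ?_
  rw [palmDensity]
  simp only [Pi.mul_apply]
  field_simp
  ring

theorem palmCount_zero (M : ℕ) : palmCount M 0 = 0 := by simp [palmCount]

theorem continuous_varTail (M : ℕ) : Continuous (varTail M) := by
  unfold varTail; fun_prop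

theorem continuous_varTailDeriv (M : ℕ) : Continuous (varTailDeriv M) := by
  unfold varTailDeriv; fun_prop

theorem continuous_varTailDeriv₂ (M : ℕ) : Continuous (varTailDeriv₂ M) := by
  unfold varTailDeriv₂; fun_prop

theorem measurable_palmDensity (M : ℕ) : Measurable (palmDensity M) := by
  have h1 := (continuous_varTail M).measurable
  have h2 := (continuous_varTailDeriv M).measurable
  have h3 := (continuous_varTailDeriv₂ M).measurable
  unfold palmDensity
  fun_prop

theorem continuousOn_palmDensity (M : ℕ) : ContinuousOn (palmDensity M) (Set.Ici 0) := by
  have h1 := continuous_varTail M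
  have h2 := continuous_varTailDeriv M
  have h3 := continuous_varTailDeriv₂ M
  have h0 : ∀ u ∈ Set.Ici (0 : ℝ), 1 + varTail M u ≠ 0 := fun u hu => by
    have := varTail_nonneg M hu
    positivity
  unfold palmDensity
  refine ContinuousOn.add ?_ ?_
  · exact ContinuousOn.div (by fun_prop) (by fun_prop) fun u hu => pow_ne_zero 3 (h0 u hu)
  · exact ContinuousOn.div (by fun_prop) (by fun_prop) fun u hu => pow_ne_zero 2 (h0 u hu)

/-- Nonnegativity is the Cauchy–Schwarz inequality for the coefficients of `varTail`. -/
theorem palmDensity_nonneg (M : ℕ) {u : ℝ} (hu : 0 ≤ u) : 0 ≤ palmDensity M u := by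
  have h0 := varTail_nonneg M hu
  have hcs : u * varTailDeriv M u ^ 2 ≤ varTail M u * varTailDeriv₂ M u := by
    set c : Fin M → ℝ := fun i => ((M + 1).choose (i + 2) : ℝ) / (M + 1) * u ^ (i : ℕ) with hc
    have hc0 : ∀ i, 0 ≤ c i := fun i => by positivity
    have h := Finset.sum_mul_sq_le_sq_mul_sq (Finset.univ : Finset (Fin M))
      (fun i => Real.sqrt (c i)) (fun i => (i + 1) * Real.sqrt (c i))
    have e1 : ∑ i : Fin M, Real.sqrt (c i) * ((i + 1) * Real.sqrt (c i)) = varTailDeriv M u := by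
      refine Finset.sum_congr rfl fun i _ => ?_
      rw [mul_left_comm, Real.mul_self_sqrt (hc0 i)]
      ring
    have e2 : u * ∑ i : Fin M, Real.sqrt (c i) ^ 2 = varTail M u := by
      rw [Finset.mul_sum]
      refine Finset.sum_congr rfl fun i _ => ?_
      rw [Real.sq_sqrt (hc0 i)]
      ring
    have e3 : ∑ i : Fin M, ((i + 1) * Real.sqrt (c i)) ^ 2 = varTailDeriv₂ M u := by
      refine Finset.sum_congr rfl fun i _ => ?_
      rw [mul_pow, Real.sq_sqrt (hc0 i)]
      ring
    rw [e1, e3] at h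
    rw [← e2, mul_assoc]
    exact mul_le_mul_of_nonneg_left h hu
  rw [palmDensity]
  have h2 : 0 ≤ varTail M u * varTailDeriv₂ M u - u * varTailDeriv M u ^ 2 := by linarith
  positivity

theorem lintegral_palmDensity (M : ℕ) {r : ℝ} (hr : 0 ≤ r) :
    ∫⁻ u in Set.Ioi 0, (Set.Iic r).indicator 1 u * ENNReal.ofReal (palmDensity M u)
      = ENNReal.ofReal (palmCount M r) := by
  have hcont : ContinuousOn (palmDensity M) (Set.uIcc 0 r) := by
    rw [Set.uIcc_of_le hr]
    exact (continuousOn_palmDensity M).mono fun u hu => hu.1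
  have hint : IntervalIntegrable (palmDensity M) volume 0 r := hcont.intervalIntegrable
  have hval : ∫ u in (0 : ℝ)..r, palmDensity M u = palmCount M r := by
    rw [intervalIntegral.integral_eq_sub_of_hasDerivAt (f := palmCount M) _ hint, palmCount_zero,
      sub_zero]
    intro u hu
    rw [Set.uIcc_of_le hr] at hu
    exact hasDerivAt_palmCount M hu.1
  rw [← hval, intervalIntegral.integral_of_le hr, ofReal_integral_eq_lintegral_ofReal
    ((intervalIntegrable_iff_integrableOn_Ioc_of_le hr).1 hint)
    ((ae_restrict_iff' measurableSet_Ioc).2 (ae_of_all _ fun u hu => palmDensity_nonneg M hu.1.le)),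
    ← lintegral_indicator measurableSet_Ioi, ← lintegral_indicator measurableSet_Ioc]
  refine lintegral_congr fun u => ?_
  by_cases h1 : 0 < u <;> by_cases h2 : u ≤ r <;>
    simp [h1, h2]

/-- The polynomial `k` such that the elliptic polynomial with coefficients `0, c, y` equals
`-√(M + 1) * X * (k - c)`: its nonzero roots are the preimages of `c` under `k`. -/
noncomputable def quotientGraphPoly {M : ℕ} (y : Fin M → ℂ) : Polynomial ℂ :=
  ∑ i : Fin M, Polynomial.C (-((Real.sqrt (((M + 1).choose (i + 2) : ℝ) / (M + 1)) : ℝ) : ℂ) * y i) *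
    Polynomial.X ^ (i + 1 : ℕ)

theorem ellipticPoly_finCons_zero_finCons {M : ℕ} (c : ℂ) (y : Fin M → ℂ) :
    ellipticPoly (M + 1) (Fin.cons 0 (Fin.cons c y))
      = Polynomial.X * (Polynomial.C (-((Real.sqrt (M + 1) : ℝ) : ℂ)) *
        (quotientGraphPoly y - Polynomial.C c)) := by
  have hs : ∀ i : Fin M, Real.sqrt ((M + 1).choose (i + 2) : ℝ)
      = Real.sqrt (M + 1) * Real.sqrt (((M + 1).choose (i + 2) : ℝ) / (M + 1)) := by
    intro i
    rw [← Real.sqrt_mul (by positivity)]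
    congr 1
    field_simp
  rw [ellipticPoly, Fin.sum_univ_succ, Fin.sum_univ_succ, quotientGraphPoly, mul_sub, mul_sub,
    Finset.mul_sum, Finset.mul_sum, sub_eq_neg_add]
  simp only [Fin.cons_zero, Fin.cons_succ, zero_mul, map_zero, zero_add, Fin.val_succ, Fin.val_zero,
    ← Polynomial.C_mul_X_pow_eq_monomial, Nat.choose_one_right]
  refine congrArg₂ (· + ·) ?_ ?_
  · simp
    ring
  · refine Finset.sum_congr rfl fun i _ => ?_
    rw [show ((i : ℕ) + 1 + 1) = i + 2 from rfl, hs]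
    simp
    ring

theorem rootSum_finCons_zero_finCons {M : ℕ} {c : ℂ} {y : Fin M → ℂ}
    (h : (Fin.cons c y : Fin (M + 1) → ℂ) (Fin.last M) ≠ 0) (φ : ℂ → ℝ≥0∞) :
    rootSum φ (Fin.cons 0 (Fin.cons c y) : Fin (M + 1 + 1) → ℂ)
      = φ 0 + ((quotientGraphPoly y - Polynomial.C c).roots.map φ).sum := by
  have hl : (Fin.cons 0 (Fin.cons c y) : Fin (M + 1 + 1) → ℂ) (Fin.last (M + 1)) ≠ 0 := by
    rwa [← Fin.succ_last, Fin.cons_succ]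
  have hne := ellipticPoly_ne_zero hl
  have hs : (-((Real.sqrt (M + 1) : ℝ) : ℂ)) ≠ 0 := by
    have : 0 < Real.sqrt ((M : ℝ) + 1) := Real.sqrt_pos.2 (by positivity)
    exact neg_ne_zero.2 (by exact_mod_cast this.ne')
  rw [rootSum, if_neg hl]
  rw [ellipticPoly_finCons_zero_finCons] at hne ⊢
  rw [Polynomial.roots_mul hne, Polynomial.roots_X, Polynomial.roots_C_mul _ hs, Multiset.map_add,
    Multiset.sum_add]
  simp

theorem ae_stdComplexGaussian_ne_zero : ∀ᵐ c ∂stdComplexGaussian, c ≠ 0 := by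
  refine (withDensity_absolutelyContinuous _ _ : stdComplexGaussian ≪ volume).ae_le ?_
  exact measure_eq_zero_iff_ae_notMem.1 (measure_singleton (0 : ℂ))

theorem ae_ae_finCons_last_ne_zero (M : ℕ) :
    ∀ᵐ y ∂(gaussianVector M), ∀ᵐ c ∂stdComplexGaussian,
      (Fin.cons c y : Fin (M + 1) → ℂ) (Fin.last M) ≠ 0 := by
  -- For `M = 0` the last coordinate is `c` itself, otherwise it is a coordinate of `y`.
  obtain _ | M := M
  · exact ae_of_all _ fun y => ae_stdComplexGaussian_ne_zero
  · filter_upwards [ae_gaussianVector_apply_ne_zero (Fin.last M)] with y hy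
    refine ae_of_all _ fun c => ?_
    rwa [← Fin.succ_last, Fin.cons_succ]

/-- The area formula for the linear coefficient `c`, the higher coefficients being fixed. The root at `0`
contributes `χ 0`, as `c` has mean square `1`. -/
theorem lintegral_rootSum_finCons_zero_finCons {M : ℕ} (χ : ℂ → ℝ≥0∞) (hχ : Measurable χ)
    {y : Fin M → ℂ} (hy : ∀ᵐ c ∂stdComplexGaussian,
      (Fin.cons c y : Fin (M + 1) → ℂ) (Fin.last M) ≠ 0) :
    ∫⁻ c, ENNReal.ofReal (‖c‖ ^ 2) * rootSum χ (Fin.cons 0 (Fin.cons c y) : Fin (M + 1 + 1) → ℂ)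
        ∂stdComplexGaussian
      = χ 0 + ∫⁻ z, χ z * (ENNReal.ofReal (1 / Real.pi) *
        (ENNReal.ofReal (Real.exp (-‖(quotientGraphPoly y).eval z‖ ^ 2)) *
        (ENNReal.ofReal (‖(quotientGraphPoly y).eval z‖ ^ 2) *
          ENNReal.ofReal (‖(quotientGraphPoly y).derivative.eval z‖ ^ 2)))) := by
  have hk := (quotientGraphPoly y).continuous.measurable
  have hcongr : ∀ᵐ c ∂stdComplexGaussian, ENNReal.ofReal (‖c‖ ^ 2) *
      rootSum χ (Fin.cons 0 (Fin.cons c y) : Fin (M + 1 + 1) → ℂ)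
      = ENNReal.ofReal (‖c‖ ^ 2) * χ 0 + ENNReal.ofReal (‖c‖ ^ 2) *
        ((quotientGraphPoly y - Polynomial.C c).roots.map χ).sum := by
    filter_upwards [hy] with c hc
    rw [rootSum_finCons_zero_finCons hc, mul_add]
  rw [lintegral_congr_ae hcongr, lintegral_add_left (by fun_prop), lintegral_mul_const _ (by fun_prop),
    lintegral_norm_sq_stdComplexGaussian, one_mul]
  congr 1
  rw [stdComplexGaussian, lintegral_withDensity_eq_lintegral_mul_non_measurable _ (by fun_prop)
    (ae_of_all _ fun _ => ENNReal.ofReal_lt_top)]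
  have harea := lintegral_sum_roots_sub_C (quotientGraphPoly y)
    (fun z => ENNReal.ofReal (Real.exp (-‖(quotientGraphPoly y).eval z‖ ^ 2) / Real.pi) *
      (ENNReal.ofReal (‖(quotientGraphPoly y).eval z‖ ^ 2) * χ z)) (by fun_prop)
  have hrhs : ∀ z, χ z * (ENNReal.ofReal (1 / Real.pi) *
        (ENNReal.ofReal (Real.exp (-‖(quotientGraphPoly y).eval z‖ ^ 2)) *
        (ENNReal.ofReal (‖(quotientGraphPoly y).eval z‖ ^ 2) *
          ENNReal.ofReal (‖(quotientGraphPoly y).derivative.eval z‖ ^ 2))))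
      = ENNReal.ofReal (‖(quotientGraphPoly y).derivative.eval z‖ ^ 2) *
      (ENNReal.ofReal (Real.exp (-‖(quotientGraphPoly y).eval z‖ ^ 2) / Real.pi) *
      (ENNReal.ofReal (‖(quotientGraphPoly y).eval z‖ ^ 2) * χ z)) := by
    intro z
    rw [div_eq_mul_one_div (Real.exp _), ENNReal.ofReal_mul (Real.exp_nonneg _)]
    ring
  rw [lintegral_congr hrhs, ← harea]
  refine lintegral_congr fun c => ?_
  simp only [Pi.mul_apply]
  rw [← Multiset.sum_map_mul_left, ← Multiset.sum_map_mul_left]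
  congr 1
  refine Multiset.map_congr rfl fun z hz => ?_
  have hz' : (quotientGraphPoly y).eval z = c := by
    have := Polynomial.isRoot_of_mem_roots hz
    rwa [Polynomial.IsRoot.def, Polynomial.eval_sub, Polynomial.eval_C, sub_eq_zero] at this
  rw [hz']

/-- Both `k(z)` and `k'(z)` are linear forms in `y`, so their joint moment is the Palm density. -/
theorem lintegral_quotientGraphPoly {M : ℕ} (z : ℂ) :
    ∫⁻ y : Fin M → ℂ, ENNReal.ofReal (Real.exp (-‖(quotientGraphPoly y).eval z‖ ^ 2)) *
        (ENNReal.ofReal (‖(quotientGraphPoly y).eval z‖ ^ 2) *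
          ENNReal.ofReal (‖(quotientGraphPoly y).derivative.eval z‖ ^ 2)) ∂(gaussianVector M)
      = ENNReal.ofReal (palmDensity M (‖z‖ ^ 2)) := by
  set q : Fin M → ℝ := fun i => Real.sqrt (((M + 1).choose (i + 2) : ℝ) / (M + 1)) with hq
  have hq2 : ∀ i, q i ^ 2 = ((M + 1).choose (i + 2) : ℝ) / (M + 1) := fun i =>
    Real.sq_sqrt (by positivity)
  have hq0 : ∀ i, 0 ≤ q i := fun i => Real.sqrt_nonneg _
  set α : Fin M → ℂ := fun i => -(q i : ℂ) * z ^ (i + 1 : ℕ) with hα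
  set β : Fin M → ℂ := fun i => -((i + 1) * q i : ℂ) * z ^ (i : ℕ) with hβ
  have hk : ∀ y : Fin M → ℂ, (quotientGraphPoly y).eval z = ∑ i, α i * y i := by
    intro y
    simp only [quotientGraphPoly, Polynomial.eval_finsetSum, Polynomial.eval_mul, Polynomial.eval_C,
      Polynomial.eval_pow, Polynomial.eval_X]
    exact Finset.sum_congr rfl fun i _ => by ring
  have hk' : ∀ y : Fin M → ℂ, (quotientGraphPoly y).derivative.eval z = ∑ i, β i * y i := by
    intro y
    simp only [quotientGraphPoly, Polynomial.derivative_sum, Polynomial.eval_finsetSum,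
      Polynomial.derivative_C_mul_X_pow, Polynomial.eval_mul, Polynomial.eval_C,
      Polynomial.eval_pow, Polynomial.eval_X, Nat.add_sub_cancel]
    exact Finset.sum_congr rfl fun i _ => by push_cast; ring
  simp_rw [hk, hk']
  rw [lintegral_two_linear_forms]
  have eA : ∑ i, ‖α i‖ ^ 2 = varTail M (‖z‖ ^ 2) := by
    refine Finset.sum_congr rfl fun i _ => ?_
    rw [norm_mul, norm_neg, Complex.norm_real, Real.norm_of_nonneg (hq0 i), norm_pow, mul_pow, hq2]
    ring
  have eB : ∑ i, ‖β i‖ ^ 2 = varTailDeriv₂ M (‖z‖ ^ 2) := by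
    refine Finset.sum_congr rfl fun i _ => ?_
    have : ((i : ℂ) + 1) * q i = (((i + 1 : ℝ) * q i : ℝ) : ℂ) := by push_cast; rfl
    rw [hβ]
    simp only
    rw [this, norm_mul, norm_neg, Complex.norm_real, Real.norm_of_nonneg
      (mul_nonneg (by positivity) (hq0 i)), norm_pow, mul_pow, mul_pow, hq2]
    ring
  have eC : ∑ i, β i * star (α i) = star z * ((varTailDeriv M (‖z‖ ^ 2) : ℝ) : ℂ) := by
    rw [varTailDeriv, Complex.ofReal_sum, Finset.mul_sum]
    refine Finset.sum_congr rfl fun i _ => ?_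
    have hs : star ((q i : ℝ) : ℂ) = q i := Complex.conj_ofReal _
    have hz : ((‖z‖ ^ 2 : ℝ) : ℂ) = z * star z := by
      rw [RCLike.star_def, Complex.mul_conj, Complex.normSq_eq_norm_sq]
    rw [← hq2, Complex.ofReal_mul, Complex.ofReal_pow, hz]
    simp only [hα, hβ, star_mul, star_neg, star_pow, hs, mul_pow]
    push_cast
    ring
  have eC' : ‖∑ i, β i * star (α i)‖ ^ 2 = ‖z‖ ^ 2 * varTailDeriv M (‖z‖ ^ 2) ^ 2 := by
    rw [eC, norm_mul, norm_star, mul_pow, Complex.norm_real, Real.norm_eq_abs, sq_abs]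
  rw [eA, eB, eC', palmDensity]

/-- The expected root sum under the Palm measure at `0`, that is, the Gaussian measure on polynomials
vanishing at `0` weighted by the squared linear coefficient. -/
theorem lintegral_palm {M : ℕ} (χ : ℂ → ℝ≥0∞) (hχ : Measurable χ) :
    ∫⁻ b : Fin (M + 1) → ℂ, ENNReal.ofReal (‖b 0‖ ^ 2) *
        rootSum χ (Fin.cons 0 b : Fin (M + 1 + 1) → ℂ) ∂(gaussianVector (M + 1))
      = χ 0 + ∫⁻ z, χ z * (ENNReal.ofReal (1 / Real.pi) *
        ENNReal.ofReal (palmDensity M (‖z‖ ^ 2))) := by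
  have hrs : Measurable fun b : Fin (M + 1) → ℂ =>
      rootSum χ (Fin.cons 0 b : Fin (M + 1 + 1) → ℂ) := by
    have h := measurable_rootSum (N := M + 1) (Y := Unit) (fun _ => χ) (hχ.comp measurable_snd)
    exact h.comp ((measurable_const (a := ())).prodMk measurable_finCons_zero)
  rw [lintegral_pi_finCons _ _ (by fun_prop)]
  have hstep : ∀ᵐ y ∂(gaussianVector M), ∫⁻ c, ENNReal.ofReal
      (‖(Fin.cons c y : Fin (M + 1) → ℂ) 0‖ ^ 2) *
        rootSum χ (Fin.cons 0 (Fin.cons c y) : Fin (M + 1 + 1) → ℂ) ∂stdComplexGaussian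
      = χ 0 + ∫⁻ z, χ z * (ENNReal.ofReal (1 / Real.pi) *
        (ENNReal.ofReal (Real.exp (-‖(quotientGraphPoly y).eval z‖ ^ 2)) *
        (ENNReal.ofReal (‖(quotientGraphPoly y).eval z‖ ^ 2) *
          ENNReal.ofReal (‖(quotientGraphPoly y).derivative.eval z‖ ^ 2)))) := by
    filter_upwards [ae_ae_finCons_last_ne_zero M] with y hy
    simp only [Fin.cons_zero]
    exact lintegral_rootSum_finCons_zero_finCons χ hχ hy
  rw [lintegral_congr_ae hstep, lintegral_add_left measurable_const, lintegral_const, measure_univ,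
    mul_one]
  congr 1
  have hg : Measurable fun p : (Fin M → ℂ) × ℂ => (quotientGraphPoly p.1).eval p.2 := by
    simp only [quotientGraphPoly, Polynomial.eval_finsetSum, Polynomial.eval_mul, Polynomial.eval_C,
      Polynomial.eval_pow, Polynomial.eval_X]
    fun_prop
  have hd : Measurable fun p : (Fin M → ℂ) × ℂ => (quotientGraphPoly p.1).derivative.eval p.2 := by
    simp only [quotientGraphPoly, Polynomial.derivative_sum, Polynomial.eval_finsetSum,
      Polynomial.derivative_C_mul_X_pow, Polynomial.eval_mul, Polynomial.eval_C,
      Polynomial.eval_pow, Polynomial.eval_X]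
    fun_prop
  rw [lintegral_lintegral_swap (by
    refine Measurable.aemeasurable ?_
    simp only [Function.uncurry_def]
    fun_prop)]
  refine lintegral_congr fun z => ?_
  have hgz : Measurable fun y : Fin M → ℂ => (quotientGraphPoly y).eval z :=
    hg.comp (measurable_id.prodMk measurable_const)
  have hdz : Measurable fun y : Fin M → ℂ => (quotientGraphPoly y).derivative.eval z :=
    hd.comp (measurable_id.prodMk measurable_const)
  rw [lintegral_const_mul _ (by fun_prop), lintegral_const_mul _ (by fun_prop),
    lintegral_quotientGraphPoly]

/-- The spherical cap around the south pole is a disc; `t < 2` keeps it away from the north pole. -/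
theorem closeIndicator_zero_eq {t : ℝ} (ht0 : 0 < t) (ht2 : t < 2) (w : ℂ) :
    closeIndicator t 0 w = (Set.Iic (t ^ 2 / (4 - t ^ 2))).indicator 1 (‖w‖ ^ 2) := by
  have h4 : 0 < 4 - t ^ 2 := by nlinarith
  have hiff : dist (stereoInv w) (stereoInv 0) ≤ t ↔ ‖w‖ ^ 2 ≤ t ^ 2 / (4 - t ^ 2) := by
    rw [← sq_le_sq₀ dist_nonneg ht0.le, dist_stereoInv_sq, le_div_iff₀ h4]
    simp only [sub_zero, norm_zero]
    rw [div_le_iff₀ (by positivity)]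
    constructor <;> intro h <;> nlinarith
  simp only [closeIndicator, Set.indicator_apply, Set.mem_ofPred_eq, Set.mem_Iic, hiff,
    Pi.one_apply]

theorem lintegral_closePairSum_eq {M : ℕ} {t : ℝ} (ht0 : 0 < t) (ht2 : t < 2) :
    ∫⁻ a : Fin (M + 1 + 1) → ℂ, closePairSum t a ∂(gaussianVector (M + 1 + 1))
      = ENNReal.ofReal ((M + 1) * (1 + palmCount M (t ^ 2 / (4 - t ^ 2)))) := by
  have h4 : 0 < 4 - t ^ 2 := by nlinarith
  set r := t ^ 2 / (4 - t ^ 2) with hr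
  have hr0 : 0 ≤ r := by positivity
  have hχ : Measurable (closeIndicator t 0) :=
    (measurable_closeIndicator t).of_uncurry_left
  have hind : Measurable ((Set.Iic r).indicator (1 : ℝ → ℝ≥0∞)) :=
    measurable_one.indicator measurableSet_Iic
  have hpd := measurable_palmDensity M
  have hpi : ENNReal.ofReal Real.pi * ENNReal.ofReal (1 / Real.pi) = 1 := by
    rw [← ENNReal.ofReal_mul Real.pi_pos.le, mul_one_div_cancel Real.pi_ne_zero, ENNReal.ofReal_one]
  rw [lintegral_closePairSum, lintegral_palm _ hχ]
  simp_rw [closeIndicator_zero_eq ht0 ht2]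
  rw [← hr, lintegral_comp_norm_sq (fun u => (Set.Iic r).indicator 1 u *
    (ENNReal.ofReal (1 / Real.pi) * ENNReal.ofReal (palmDensity M u))) (by fun_prop)]
  simp_rw [mul_left_comm _ (ENNReal.ofReal (1 / Real.pi))]
  rw [lintegral_const_mul _ (by fun_prop), ← mul_assoc, hpi, one_mul, lintegral_palmDensity M hr0]
  have hpc : 0 ≤ palmCount M r := by
    have h1 := varTail_nonneg M hr0
    have h2 : 0 ≤ varTailDeriv M r := Finset.sum_nonneg fun i _ => by positivity
    rw [palmCount]
    positivity
  have hN : ((M : ℝ≥0∞) + 1) = ENNReal.ofReal ((M : ℝ) + 1) := by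
    rw [ENNReal.ofReal_add (Nat.cast_nonneg _) zero_le_one, ENNReal.ofReal_natCast,
      ENNReal.ofReal_one]
  rw [hN, ENNReal.ofReal_mul (by positivity), ENNReal.ofReal_add zero_le_one hpc, ENNReal.ofReal_one]
  congr 2
  simp [hr0]

/-! ### Closed form and bounds for the Palm count -/

theorem mul_one_add_varTail (M : ℕ) (u : ℝ) :
    (M + 1) * u * (1 + varTail M u) = (1 + u) ^ (M + 1) - 1 := by
  have h := add_pow u 1 (M + 1)
  rw [Finset.sum_range, Fin.sum_univ_succ, Fin.sum_univ_succ] at h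
  have hsum : (M + 1) * u * varTail M u = ∑ i : Fin M, u ^ (i + 2 : ℕ) * ((M + 1).choose (i + 2) : ℝ) := by
    rw [varTail, Finset.mul_sum]
    refine Finset.sum_congr rfl fun i _ => ?_
    have : (M + 1 : ℝ) ≠ 0 := by positivity
    field_simp
    ring
  have h0 : ∑ i : Fin M, u ^ ((i.succ.succ : Fin (M + 1 + 1)) : ℕ) *
      1 ^ (M + 1 - ((i.succ.succ : Fin (M + 1 + 1)) : ℕ)) *
      ((M + 1).choose ((i.succ.succ : Fin (M + 1 + 1)) : ℕ) : ℝ)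
      = (M + 1) * u * varTail M u := by
    rw [hsum]
    exact Finset.sum_congr rfl fun i _ => by simp [add_assoc]
  rw [h0] at h
  simp at h
  rw [add_comm 1 u]
  linarith

theorem mul_varTailDeriv (M : ℕ) (u : ℝ) :
    u * varTailDeriv M u = (1 + u) ^ M - (1 + varTail M u) := by
  have h1 : HasDerivAt (fun u => (M + 1) * u * (1 + varTail M u))
      ((M + 1) * (1 + varTail M u) + (M + 1) * u * varTailDeriv M u) u := by
    refine (((hasDerivAt_id' u).const_mul ((M : ℝ) + 1)).fun_mul
      ((hasDerivAt_varTail M u).const_add 1)).congr_deriv ?_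
    simp
  have h2 : HasDerivAt (fun u : ℝ => (1 + u) ^ (M + 1) - 1) ((M + 1) * (1 + u) ^ M) u := by
    refine ((((hasDerivAt_id' u).const_add 1).fun_pow (M + 1)).sub_const 1).congr_deriv ?_
    simp
  simp_rw [mul_one_add_varTail] at h1
  have h := h1.unique h2
  have hM : (M + 1 : ℝ) ≠ 0 := by positivity
  have : (M + 1 : ℝ) * (u * varTailDeriv M u - ((1 + u) ^ M - (1 + varTail M u))) = 0 := by
    linarith
  have := (mul_eq_zero.1 this).resolve_left hM
  linarith

theorem palmCount_eq (M : ℕ) {u : ℝ} (hu : 0 < u) :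
    palmCount M u = ((M + 1) * u * (1 + u) ^ M - ((1 + u) ^ (M + 1) - 1)) *
      ((1 + u) ^ (M + 1) - 1 - (M + 1) * u) / ((1 + u) ^ (M + 1) - 1) ^ 2 := by
  have h0 : 1 + varTail M u ≠ 0 := by
    have := varTail_nonneg M hu.le
    positivity
  have hM : (M + 1 : ℝ) ≠ 0 := by positivity
  rw [← mul_one_add_varTail, palmCount, mul_varTailDeriv]
  field_simp
  ring

theorem palmCount_nonneg (M : ℕ) {u : ℝ} (hu : 0 ≤ u) : 0 ≤ palmCount M u := by
  have h1 := varTail_nonneg M hu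
  have h2 : 0 ≤ varTailDeriv M u := Finset.sum_nonneg fun i _ => by positivity
  rw [palmCount]
  positivity

/-- The arithmetic-geometric mean inequality for the two factors of the closed form. -/
theorem palmCount_le (M : ℕ) {u : ℝ} (hu : 0 < u) :
    palmCount M u ≤ (M + 1) ^ 2 * u ^ 2 / (4 * (1 + u) ^ 2) := by
  have hq : 1 ≤ 1 + u := by linarith
  have hQq : 1 + u ≤ (1 + u) ^ (M + 1) := le_self_pow₀ hq (Nat.succ_ne_zero M)
  have hQ : 0 < (1 + u) ^ (M + 1) - 1 := by linarith
  rw [palmCount_eq M hu, div_le_div_iff₀ (by positivity) (by positivity)]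
  have hps : (1 + u) ^ (M + 1) = (1 + u) * (1 + u) ^ M := pow_succ' _ _
  set Q := (1 + u) ^ (M + 1) with hQdef
  -- `X + Y` loses the terms `Q - 1`, which makes the two sides comparable.
  set X := (1 + u) * ((M + 1) * u * (1 + u) ^ M - (Q - 1)) with hX
  set Y := (1 + u) * (Q - 1 - (M + 1) * u) with hY
  have hXY : X + Y = (M + 1) * u * (Q - (1 + u)) := by
    rw [hX, hY]
    linear_combination (-(M + 1) * u) * hps
  have hamgm : 4 * (X * Y) ≤ (X + Y) ^ 2 := by nlinarith [sq_nonneg (X - Y)]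
  have hle : (Q - (1 + u)) ^ 2 ≤ (Q - 1) ^ 2 := pow_le_pow_left₀ (by linarith) (by linarith) 2
  calc _ = 4 * (X * Y) := by rw [hX, hY]; ring
    _ ≤ (X + Y) ^ 2 := hamgm
    _ = ((M + 1) ^ 2 * u ^ 2) * (Q - (1 + u)) ^ 2 := by rw [hXY]; ring
    _ ≤ _ := mul_le_mul_of_nonneg_left hle (by positivity)

/-- Bound `varTail` and its derivative below by their first terms and `1 + varTail` above by an
exponential. -/
theorem le_palmCount (M : ℕ) {u : ℝ} (hu : 0 ≤ u) :
    (M : ℝ) ^ 2 * u ^ 2 / 4 * Real.exp (-(2 * ((M + 1) * u))) ≤ palmCount M u := by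
  obtain _ | K := M
  · simpa using palmCount_nonneg 0 hu
  have hc : (((K + 1 + 1).choose 2 : ℕ) : ℝ) / ((K + 1 : ℕ) + 1) = ((K + 1 : ℕ) : ℝ) / 2 := by
    rw [Nat.cast_choose_two]
    push_cast
    have : (K + 1 + 1 : ℝ) ≠ 0 := by positivity
    field_simp
    ring
  have hA : ((K + 1 : ℕ) : ℝ) / 2 * u ≤ varTail (K + 1) u := by
    rw [← hc]
    have := Finset.single_le_sum (f := fun i : Fin (K + 1) =>
      ((K + 1 + 1).choose (i + 2) : ℝ) / ((K + 1 : ℕ) + 1) * u ^ (i + 1 : ℕ))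
      (fun i _ => by positivity) (Finset.mem_univ 0)
    simpa [varTail] using this
  have hD : ((K + 1 : ℕ) : ℝ) / 2 ≤ varTailDeriv (K + 1) u := by
    rw [← hc]
    have := Finset.single_le_sum (f := fun i : Fin (K + 1) =>
      (i + 1) * (((K + 1 + 1).choose (i + 2) : ℝ) / ((K + 1 : ℕ) + 1)) * u ^ (i : ℕ))
      (fun i _ => by positivity) (Finset.mem_univ 0)
    simpa [varTailDeriv] using this
  set M := K + 1
  have hA0 := varTail_nonneg M hu
  have hD0 : 0 ≤ varTailDeriv M u := le_trans (by positivity) hD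
  have hσ : 1 + varTail M u ≤ Real.exp ((M + 1) * u) := by
    have h1 := mul_varTailDeriv M u
    have h2 : 0 ≤ u * varTailDeriv M u := mul_nonneg hu hD0
    have h3 : (1 + u) ^ M ≤ Real.exp u ^ M :=
      pow_le_pow_left₀ (by linarith) (by linarith [Real.add_one_le_exp u]) M
    rw [← Real.exp_nat_mul] at h3
    have h4 : Real.exp (M * u) ≤ Real.exp ((M + 1) * u) := Real.exp_le_exp.2 (by linarith)
    linarith
  rw [palmCount, le_div_iff₀ (by positivity)]
  have hσ2 : (1 + varTail M u) ^ 2 ≤ Real.exp (2 * ((M + 1) * u)) := by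
    have := pow_le_pow_left₀ (by linarith) hσ 2
    rwa [← Real.exp_nat_mul, Nat.cast_ofNat] at this
  calc (M : ℝ) ^ 2 * u ^ 2 / 4 * Real.exp (-(2 * ((M + 1) * u))) * (1 + varTail M u) ^ 2
      ≤ (M : ℝ) ^ 2 * u ^ 2 / 4 * Real.exp (-(2 * ((M + 1) * u))) * Real.exp (2 * ((M + 1) * u)) := by
        gcongr
    _ = u * ((M : ℝ) / 2) * ((M : ℝ) / 2 * u) := by
        rw [mul_assoc, ← Real.exp_add]
        simp
        ring
    _ ≤ u * varTailDeriv M u * varTail M u := by gcongr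

/-- The closed form of the expected number of pairs, in the chordal variable. -/
theorem half_mul_palmCount_eq (M : ℕ) {t : ℝ} (ht0 : 0 < t) (ht2 : t < 2) :
    (M + 1) / 2 * palmCount M (t ^ 2 / (4 - t ^ 2)) =
      t ^ 2 * (M + 1) ^ 2 / 8 - (M + 1) / 2 +
          t ^ 2 * (M + 1) ^ 2 / (8 * (4 - t ^ 2) * ((4 / (4 - t ^ 2)) ^ (M + 1) - 1)) *
            (8 - t ^ 2 - t ^ 2 * (M + 1) -
              t ^ 2 * (M + 1) / ((4 / (4 - t ^ 2)) ^ (M + 1) - 1)) := by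
  have h4 : 0 < 4 - t ^ 2 := by nlinarith
  have hu : 0 < t ^ 2 / (4 - t ^ 2) := by positivity
  have hq : 1 + t ^ 2 / (4 - t ^ 2) = 4 / (4 - t ^ 2) := by
    field_simp
    ring
  have hq1 : 1 < 4 / (4 - t ^ 2) := by linarith
  have hQ : (4 / (4 - t ^ 2)) ^ (M + 1) - 1 ≠ 0 :=
    (sub_pos.2 (one_lt_pow₀ hq1 (Nat.succ_ne_zero M))).ne'
  have hpow : (4 / (4 - t ^ 2)) ^ M = (4 / (4 - t ^ 2)) ^ (M + 1) * ((4 - t ^ 2) / 4) := by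
    rw [pow_succ _ M, mul_assoc, div_mul_div_cancel₀ h4.ne', div_self four_ne_zero, mul_one]
  rw [palmCount_eq M hu, hq, hpow]
  generalize (4 / (4 - t ^ 2)) ^ (M + 1) = Q at hQ ⊢
  field_simp
  ring

/-! ### Counting pairs -/

theorem pairCount_eq_card {N : ℕ} (t : ℝ) (x : Fin N → UnitSphere) :
    pairCount t x = (Finset.univ.filter fun p : Fin N × Fin N =>
      p.1 < p.2 ∧ dist (x p.1) (x p.2) ≤ t).card := by
  classical
  rw [pairCount, Nat.card_eq_fintype_card, Fintype.card_subtype]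

theorem pairCount_mono {N : ℕ} {s t : ℝ} (hst : s ≤ t) (x : Fin N → UnitSphere) :
    pairCount s x ≤ pairCount t x := by
  rw [pairCount_eq_card, pairCount_eq_card]
  exact Finset.card_le_card fun p hp => by
    simp only [Finset.mem_filter, Finset.mem_univ, true_and] at hp ⊢
    exact ⟨hp.1, hp.2.trans hst⟩

theorem pairCount_of_neg {N : ℕ} {t : ℝ} (ht : t < 0) (x : Fin N → UnitSphere) :
    pairCount t x = 0 := by
  rw [pairCount_eq_card, Finset.card_eq_zero, Finset.filter_eq_empty_iff]
  rintro p - ⟨-, h⟩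
  linarith [dist_nonneg (x := x p.1) (y := x p.2)]

/-- Each close pair `i < j` counts twice among ordered pairs, which also include the diagonal. -/
theorem card_filter_dist_le {N : ℕ} {t : ℝ} (ht : 0 ≤ t) (x : Fin N → UnitSphere) :
    (Finset.univ.filter fun p : Fin N × Fin N => dist (x p.1) (x p.2) ≤ t).card
      = N + 2 * pairCount t x := by
  classical
  set A := Finset.univ.filter fun p : Fin N × Fin N => p.1 < p.2 ∧ dist (x p.1) (x p.2) ≤ t with hA
  set B := Finset.univ.filter fun p : Fin N × Fin N => p.2 < p.1 ∧ dist (x p.1) (x p.2) ≤ t with hB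
  set D := Finset.univ.filter fun p : Fin N × Fin N => p.1 = p.2 with hD
  have hAB : B.card = A.card := by
    refine Finset.card_bij (fun p _ => p.swap) ?_ ?_ ?_
    · intro p hp
      simp only [hA, hB, Finset.mem_filter, Finset.mem_univ, true_and, Prod.fst_swap,
        Prod.snd_swap] at hp ⊢
      rwa [dist_comm]
    · intro p _ q _ h
      exact Prod.swap_injective h
    · intro p hp
      refine ⟨p.swap, ?_, Prod.swap_swap p⟩
      simp only [hA, hB, Finset.mem_filter, Finset.mem_univ, true_and, Prod.fst_swap,
        Prod.snd_swap] at hp ⊢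
      rwa [dist_comm]
  have hDc : D.card = N := by
    have : D = Finset.univ.image fun i : Fin N => (i, i) := by
      ext ⟨i, j⟩
      simp only [hD, Finset.mem_filter, Finset.mem_univ, true_and, Finset.mem_image, Prod.mk.injEq]
      exact ⟨fun h => ⟨i, rfl, h⟩, fun ⟨k, h1, h2⟩ => h1.symm.trans h2⟩
    rw [this, Finset.card_image_of_injective _ fun i j h => (Prod.mk.inj h).1]
    simp
  have hunion : (Finset.univ.filter fun p : Fin N × Fin N => dist (x p.1) (x p.2) ≤ t)
      = D ∪ (A ∪ B) := by
    ext p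
    simp only [hA, hB, hD, Finset.mem_union, Finset.mem_filter, Finset.mem_univ, true_and]
    constructor
    · intro h
      rcases lt_trichotomy p.1 p.2 with h1 | h1 | h1
      · exact Or.inr (Or.inl ⟨h1, h⟩)
      · exact Or.inl h1
      · exact Or.inr (Or.inr ⟨h1, h⟩)
    · rintro (h | h | h)
      · rw [h, dist_self]
        exact ht
      · exact h.2
      · exact h.2
  have hd1 : Disjoint A B := by
    rw [Finset.disjoint_left]
    intro p h1 h2
    simp only [hA, hB, Finset.mem_filter] at h1 h2
    exact lt_asymm h1.2.1 h2.2.1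
  have hd2 : Disjoint D (A ∪ B) := by
    rw [Finset.disjoint_left]
    intro p h1 h2
    simp only [hA, hB, hD, Finset.mem_union, Finset.mem_filter, Finset.mem_univ, true_and] at h1 h2
    rcases h2 with h2 | h2
    · exact h2.1.ne h1
    · exact h2.1.ne h1.symm
  rw [hunion, Finset.card_union_of_disjoint hd2, Finset.card_union_of_disjoint hd1, hAB, hDc,
    pairCount_eq_card]
  ring

theorem add_two_mul_pairCount_le {N : ℕ} (t : ℝ) (x : Fin N → UnitSphere) :
    N + 2 * pairCount t x ≤ N * N := by
  refine (Nat.add_le_add_left (Nat.mul_le_mul_left 2 (pairCount_mono (le_max_left t 0) x)) N).trans ?_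
  rw [← card_filter_dist_le (le_max_right t 0)]
  refine (Finset.card_filter_le _ _).trans ?_
  simp

theorem closePairSum_eq {N : ℕ} {t : ℝ} (ht : 0 ≤ t) {a : Fin (N + 1) → ℂ}
    (ha : a (Fin.last N) ≠ 0) {x : Fin N → UnitSphere}
    (hx : (Finset.univ : Finset (Fin N)).val.map x = (ellipticPoly N a).roots.map stereoInv) :
    closePairSum t a = ((N + 2 * pairCount t x : ℕ) : ℝ≥0∞) := by
  classical
  set f : UnitSphere → UnitSphere → ℝ≥0∞ := fun p q => if dist q p ≤ t then 1 else 0 with hf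
  have hfc : ∀ z w, closeIndicator t z w = f (stereoInv z) (stereoInv w) := fun z w => by
    simp only [closeIndicator, Set.indicator_apply, Set.mem_ofPred_eq, Pi.one_apply, hf]
  have hinner : ∀ z, rootSum (closeIndicator t z) a = ∑ j, f (stereoInv z) (x j) := by
    intro z
    have h := congrArg (fun m => (m.map (f (stereoInv z))).sum) hx
    simp only [Multiset.map_map] at h
    rw [rootSum, if_neg ha]
    simp only [hfc]
    exact h.symm
  have houter : closePairSum t a = ∑ i, ∑ j, f (x i) (x j) := by
    have h := congrArg (fun m => (m.map fun p => ∑ j, f p (x j)).sum) hx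
    simp only [Multiset.map_map] at h
    rw [closePairSum, rootSum, if_neg ha]
    simp only [hinner]
    exact h.symm
  rw [houter, ← card_filter_dist_le ht, ← Finset.sum_product', Finset.univ_product_univ,
    Finset.card_filter]
  push_cast
  refine Finset.sum_congr rfl fun p _ => ?_
  simp only [hf, dist_comm]

section Law

variable {Ω : Type*} [MeasurableSpace Ω] {P : Measure Ω} {N : ℕ}
  {a : Fin (N + 1) → Ω → ℂ} {x : Fin N → Ω → UnitSphere}

theorem ae_closePairSum_eq (ha : HasLaw (fun ω n => a n ω) (gaussianVector (N + 1)) P)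
    (hx : ∀ᵐ ω ∂P, (Finset.univ : Finset (Fin N)).val.map (fun i => x i ω) =
      (ellipticPoly N (fun n => a n ω)).roots.map stereoInv) {t : ℝ} (ht : 0 ≤ t) :
    ∀ᵐ ω ∂P, closePairSum t (fun n => a n ω)
      = ((N + 2 * pairCount t (fun i => x i ω) : ℕ) : ℝ≥0∞) := by
  have hlast : ∀ᵐ ω ∂P, a (Fin.last N) ω ≠ 0 := by
    have h := ae_gaussianVector_apply_ne_zero (Fin.last N)
    rw [← ha.map_eq] at h
    exact ae_of_ae_map ha.aemeasurable h
  filter_upwards [hlast, hx] with ω h1 h2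
  exact closePairSum_eq ht h1 h2

theorem integrable_pairCount [IsProbabilityMeasure P]
    (ha : HasLaw (fun ω n => a n ω) (gaussianVector (N + 1)) P)
    (hx : ∀ᵐ ω ∂P, (Finset.univ : Finset (Fin N)).val.map (fun i => x i ω) =
      (ellipticPoly N (fun n => a n ω)).roots.map stereoInv) (t : ℝ) :
    Integrable (fun ω => (pairCount t (fun i => x i ω) : ℝ)) P := by
  rcases lt_or_ge t 0 with ht | ht
  · simp [pairCount_of_neg ht]
  have hmeas : AEMeasurable (fun ω => (pairCount t (fun i => x i ω) : ℝ)) P := by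
    have h1 : AEMeasurable (fun ω => ((closePairSum t (fun n => a n ω)).toReal - N) / 2) P :=
      (((measurable_closePairSum t).comp_aemeasurable ha.aemeasurable).ennreal_toReal.sub_const
        _).div_const _
    refine h1.congr ?_
    filter_upwards [ae_closePairSum_eq ha hx ht] with ω hω
    rw [hω, ENNReal.toReal_natCast]
    push_cast
    ring
  refine Integrable.of_bound hmeas.aestronglyMeasurable ((N : ℝ) * N) (ae_of_all _ fun ω => ?_)
  have h := add_two_mul_pairCount_le t fun i => x i ω
  rw [Real.norm_of_nonneg (Nat.cast_nonneg _)]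
  have : pairCount t (fun i => x i ω) ≤ N * N := by omega
  exact_mod_cast this

theorem integral_pairCount [IsProbabilityMeasure P] {M : ℕ}
    {a : Fin (M + 1 + 1) → Ω → ℂ} {x : Fin (M + 1) → Ω → UnitSphere}
    (ha : HasLaw (fun ω n => a n ω) (gaussianVector (M + 1 + 1)) P)
    (hx : ∀ᵐ ω ∂P, (Finset.univ : Finset (Fin (M + 1))).val.map (fun i => x i ω) =
      (ellipticPoly (M + 1) (fun n => a n ω)).roots.map stereoInv) {t : ℝ} (ht0 : 0 < t)
    (ht2 : t < 2) :
    ∫ ω, (pairCount t (fun i => x i ω) : ℝ) ∂P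
      = (M + 1) / 2 * palmCount M (t ^ 2 / (4 - t ^ 2)) := by
  have hint := integrable_pairCount ha hx t
  have h4 : 0 < 4 - t ^ 2 := by nlinarith
  have hpc := palmCount_nonneg M (u := t ^ 2 / (4 - t ^ 2)) (by positivity)
  have h1 : ∫⁻ ω, ENNReal.ofReal ((M + 1) + 2 * (pairCount t (fun i => x i ω) : ℝ)) ∂P
      = ENNReal.ofReal ((M + 1) * (1 + palmCount M (t ^ 2 / (4 - t ^ 2)))) := by
    rw [← lintegral_closePairSum_eq ht0 ht2,
      ← ha.lintegral_comp (measurable_closePairSum t).aemeasurable]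
    refine lintegral_congr_ae ?_
    filter_upwards [ae_closePairSum_eq ha hx ht0.le] with ω hω
    rw [hω, ← ENNReal.ofReal_natCast]
    push_cast
    rfl
  have hint2 : Integrable (fun ω => ((M : ℝ) + 1) + 2 * (pairCount t (fun i => x i ω) : ℝ)) P :=
    (integrable_const _).add (hint.const_mul 2)
  rw [← ofReal_integral_eq_lintegral_ofReal hint2
    (ae_of_all _ fun ω => by positivity),
    ENNReal.ofReal_eq_ofReal_iff (integral_nonneg fun ω => by positivity) (by positivity),
    integral_add (integrable_const _) (hint.const_mul 2), integral_const_mul, integral_const] at h1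
  simp at h1
  linarith

/-- The open range `0 < t < 2` is `palmCount_le`; `t = 0` follows by monotonicity in `t`, and at `t = 2`
all pairs are counted. -/
theorem integral_pairCount_le [IsProbabilityMeasure P] {M : ℕ} {a : Fin (M + 1 + 1) → Ω → ℂ}
    {x : Fin (M + 1) → Ω → UnitSphere}
    (ha : HasLaw (fun ω n => a n ω) (gaussianVector (M + 1 + 1)) P)
    (hx : ∀ᵐ ω ∂P, (Finset.univ : Finset (Fin (M + 1))).val.map (fun i => x i ω) =
      (ellipticPoly (M + 1) (fun n => a n ω)).roots.map stereoInv) {t : ℝ} (ht2 : t ≤ 2) :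
    ∫ ω, (pairCount t (fun i => x i ω) : ℝ) ∂P ≤ (M + 1) ^ 3 * t ^ 4 / 128 := by
  have hpos : ∀ s : ℝ, 0 < s → s < 2 →
      ∫ ω, (pairCount s (fun i => x i ω) : ℝ) ∂P ≤ (M + 1) ^ 3 * s ^ 4 / 128 := by
    intro s hs0 hs2
    have h4 : 0 < 4 - s ^ 2 := by nlinarith
    rw [integral_pairCount ha hx hs0 hs2]
    have h := palmCount_le M (u := s ^ 2 / (4 - s ^ 2)) (by positivity)
    have hq : 1 + s ^ 2 / (4 - s ^ 2) = 4 / (4 - s ^ 2) := by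
      field_simp
      ring
    rw [hq] at h
    calc _ ≤ (M + 1) / 2 * ((M + 1) ^ 2 * (s ^ 2 / (4 - s ^ 2)) ^ 2 / (4 * (4 / (4 - s ^ 2)) ^ 2)) :=
          mul_le_mul_of_nonneg_left h (by positivity)
      _ = _ := by
          field_simp
          ring
  rcases lt_trichotomy t 0 with ht | rfl | ht
  · simp only [pairCount_of_neg ht, Nat.cast_zero, integral_zero]
    positivity
  · have hlim : Tendsto (fun s : ℝ => ((M : ℝ) + 1) ^ 3 * s ^ 4 / 128) (nhdsWithin 0 (Set.Ioi 0))
        (nhds (((M : ℝ) + 1) ^ 3 * 0 ^ 4 / 128)) := by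
      refine Tendsto.mono_left (Continuous.tendsto ?_ 0) nhdsWithin_le_nhds
      fun_prop
    refine ge_of_tendsto hlim ?_
    filter_upwards [Ioo_mem_nhdsGT (show (0 : ℝ) < 2 by norm_num)] with s hs
    refine le_trans (integral_mono (integrable_pairCount ha hx 0) (integrable_pairCount ha hx s)
      fun ω => ?_) (hpos s hs.1 hs.2)
    simp only [Nat.cast_le]
    exact pairCount_mono hs.1.le _
  · rcases ht2.eq_or_lt with rfl | ht2
    · have hb : ∀ ω, (pairCount 2 (fun i => x i ω) : ℝ) ≤ (M + 1) * M / 2 := by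
        intro ω
        have h := add_two_mul_pairCount_le 2 fun i => x i ω
        have h' : ((M + 1 : ℕ) : ℝ) + 2 * (pairCount 2 fun i => x i ω) ≤ ((M + 1 : ℕ) : ℝ) * (M + 1 : ℕ) := by
          exact_mod_cast h
        push_cast at h'
        linarith
      have h := integral_mono (integrable_pairCount ha hx 2) (integrable_const (μ := P) _) hb
      rw [integral_const] at h
      simp at h
      have hM : (0 : ℝ) ≤ M := Nat.cast_nonneg M
      refine h.trans ?_
      have : 0 ≤ ((M : ℝ) + 1) * ((M : ℝ) - 1) ^ 2 := by positivity
      linarith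
    · exact hpos t ht ht2

theorem le_integral_pairCount [IsProbabilityMeasure P] {M : ℕ} {a : Fin (M + 1 + 1) → Ω → ℂ}
    {x : Fin (M + 1) → Ω → UnitSphere}
    (ha : HasLaw (fun ω n => a n ω) (gaussianVector (M + 1 + 1)) P)
    (hx : ∀ᵐ ω ∂P, (Finset.univ : Finset (Fin (M + 1))).val.map (fun i => x i ω) =
      (ellipticPoly (M + 1) (fun n => a n ω)).roots.map stereoInv) {t : ℝ} (ht0 : 0 ≤ t)
    (ht2 : t < 2) :
    (M / (M + 1)) ^ 2 * Real.exp (-(2 * ((M + 1) * t ^ 2 / (4 - t ^ 2)))) *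
      ((M + 1) ^ 3 * t ^ 4 / 128) ≤ ∫ ω, (pairCount t (fun i => x i ω) : ℝ) ∂P := by
  rcases ht0.eq_or_lt with rfl | ht0
  · simp only [ne_eq, OfNat.ofNat_ne_zero, not_false_eq_true, zero_pow, mul_zero, zero_div]
    exact integral_nonneg fun ω => Nat.cast_nonneg _
  have h4 : 0 < 4 - t ^ 2 := by nlinarith
  have h := le_palmCount M (u := t ^ 2 / (4 - t ^ 2)) (by positivity)
  rw [integral_pairCount ha hx ht0 ht2]
  refine le_trans ?_ (mul_le_mul_of_nonneg_left h (by positivity))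
  rw [mul_div_assoc]
  have h16 : t ^ 4 / 16 ≤ (t ^ 2 / (4 - t ^ 2)) ^ 2 := by
    rw [div_pow, ← pow_mul]
    exact div_le_div_of_nonneg_left (by positivity) (by positivity) (by nlinarith)
  set E := Real.exp (-(2 * ((M + 1) * (t ^ 2 / (4 - t ^ 2)))))
  calc (M / (M + 1)) ^ 2 * E * ((M + 1) ^ 3 * t ^ 4 / 128)
      = (M + 1) / 2 * ((M : ℝ) ^ 2 * (t ^ 4 / 16) / 4 * E) := by
        field_simp
        ring
    _ ≤ _ := by gcongr

end Law

/-- The ratio of the lower to the upper bound tends to `1` when `t = o(1 / √N)`. -/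
theorem tendsto_lower_factor {t : ℕ → ℝ} (ht0 : ∀ N, 0 ≤ t N)
    (ht : t =o[atTop] (fun N : ℕ => 1 / Real.sqrt (N : ℝ))) :
    (∀ᶠ N in atTop, t N < 2) ∧
    Tendsto (fun N : ℕ => (((N : ℝ) - 1) / N) ^ 2 *
      Real.exp (-(2 * (N * t N ^ 2 / (4 - t N ^ 2))))) atTop (nhds 1) := by
  have h1 : Tendsto (fun N : ℕ => t N * Real.sqrt N) atTop (nhds 0) := by
    refine ht.tendsto_div_nhds_zero.congr fun N => ?_
    simp
  have h2 : Tendsto t atTop (nhds 0) := by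
    refine squeeze_zero' (Eventually.of_forall ht0) ?_ h1
    filter_upwards [eventually_ge_atTop 1] with N hN
    refine le_mul_of_one_le_right (ht0 N) ?_
    rw [Real.one_le_sqrt]
    exact_mod_cast hN
  have h3 : Tendsto (fun N : ℕ => (N : ℝ) * t N ^ 2) atTop (nhds 0) := by
    have := h1.pow 2
    rw [zero_pow two_ne_zero] at this
    refine this.congr fun N => ?_
    rw [mul_pow, Real.sq_sqrt (Nat.cast_nonneg _)]
    ring
  have h4 : Tendsto (fun N : ℕ => Real.exp (-(2 * (N * t N ^ 2 / (4 - t N ^ 2))))) atTop (nhds 1) := by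
    have : Tendsto (fun N : ℕ => -(2 * (N * t N ^ 2 / (4 - t N ^ 2)))) atTop
        (nhds (-(2 * (0 / (4 - 0 ^ 2))))) :=
      ((h3.div ((h2.pow 2).const_sub 4) (by norm_num)).const_mul 2).neg
    have h := (Real.continuous_exp.tendsto _).comp this
    simpa [Function.comp_def] using h
  have h5 : Tendsto (fun N : ℕ => (((N : ℝ) - 1) / N) ^ 2) atTop (nhds 1) := by
    have : Tendsto (fun N : ℕ => 1 - 1 / (N : ℝ)) atTop (nhds (1 - 0)) :=
      tendsto_one_div_atTop_nhds_zero_nat.const_sub 1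
    have := this.pow 2
    rw [sub_zero, one_pow] at this
    refine this.congr' ?_
    filter_upwards [eventually_ge_atTop 1] with N hN
    have : (N : ℝ) ≠ 0 := by positivity
    rw [sub_div, div_self this]
  refine ⟨h2.eventually_lt_const (by norm_num), ?_⟩
  simpa using h5.mul h4

theorem theorem2 {Ω : ℕ → Type*} [∀ N, MeasurableSpace (Ω N)]
    (P : ∀ N, Measure (Ω N)) [∀ N, IsProbabilityMeasure (P N)]
    (a : ∀ N, Fin (N + 1) → Ω N → ℂ)
    (ha_law : ∀ N n, HasLaw (a N n) stdComplexGaussian (P N))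
    (ha_indep : ∀ N, iIndepFun (a N) (P N))
    (x : ∀ N, Fin N → Ω N → UnitSphere)
    (hx : ∀ N, ∀ᵐ ω ∂(P N),
      (Finset.univ : Finset (Fin N)).val.map (fun i => x N i ω) =
        (ellipticPoly N (fun n => a N n ω)).roots.map stereoInv) :
    (∀ N : ℕ, 1 ≤ N → ∀ t : ℝ,
      Integrable (fun ω => (pairCount t (fun i => x N i ω) : ℝ)) (P N)) ∧
    (∀ N : ℕ, 1 ≤ N → ∀ t : ℝ, 0 < t → t < 2 →
      ∫ ω, (pairCount t (fun i => x N i ω) : ℝ) ∂(P N) =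
        t ^ 2 * (N : ℝ) ^ 2 / 8 - (N : ℝ) / 2 +
          t ^ 2 * (N : ℝ) ^ 2 / (8 * (4 - t ^ 2) * ((4 / (4 - t ^ 2)) ^ N - 1)) *
            (8 - t ^ 2 - t ^ 2 * (N : ℝ) -
              t ^ 2 * (N : ℝ) / ((4 / (4 - t ^ 2)) ^ N - 1))) ∧
    (∀ t : ℕ → ℝ, (∀ N, 0 ≤ t N) →
      t =o[atTop] (fun N : ℕ => 1 / Real.sqrt (N : ℝ)) →
      (fun N : ℕ => ∫ ω, (pairCount (t N) (fun i => x N i ω) : ℝ) ∂(P N)) ~[atTop]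
        (fun N : ℕ => (N : ℝ) ^ 3 * t N ^ 4 / 128)) ∧
    (∀ N : ℕ, 1 ≤ N → ∀ t : ℝ, t ≤ 2 →
      ∫ ω, (pairCount t (fun i => x N i ω) : ℝ) ∂(P N) ≤ (N : ℝ) ^ 3 * t ^ 4 / 128) := by
  have hlaw : ∀ N, HasLaw (fun ω n => a N n ω) (gaussianVector (N + 1)) (P N) := fun N =>
    (ha_indep N).hasLaw_pi (ha_law N)
  have hupper : ∀ N : ℕ, 1 ≤ N → ∀ t : ℝ, t ≤ 2 →
      ∫ ω, (pairCount t (fun i => x N i ω) : ℝ) ∂(P N) ≤ (N : ℝ) ^ 3 * t ^ 4 / 128 := by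
    intro N hN t ht
    obtain ⟨M, rfl⟩ : ∃ M, N = M + 1 := ⟨N - 1, by omega⟩
    push_cast
    exact integral_pairCount_le (hlaw _) (hx _) ht
  refine ⟨fun N _ t => integrable_pairCount (hlaw N) (hx N) t, ?_, ?_, hupper⟩
  · intro N hN t ht0 ht2
    obtain ⟨M, rfl⟩ : ∃ M, N = M + 1 := ⟨N - 1, by omega⟩
    rw [integral_pairCount (hlaw _) (hx _) ht0 ht2, half_mul_palmCount_eq M ht0 ht2]
    push_cast
    rfl
  · intro t ht0 ht
    obtain ⟨hlt, hlim⟩ := tendsto_lower_factor ht0 ht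
    refine isLittleO_iff.2 fun ε hε => ?_
    filter_upwards [hlt, hlim.eventually_const_lt (show 1 - ε < 1 by linarith),
      eventually_ge_atTop 1] with N hN2 hNε hN1
    have hup := hupper N hN1 (t N) hN2.le
    have hlow : (((N : ℝ) - 1) / N) ^ 2 * Real.exp (-(2 * (N * t N ^ 2 / (4 - t N ^ 2)))) *
        ((N : ℝ) ^ 3 * t N ^ 4 / 128) ≤
        ∫ ω, (pairCount (t N) (fun i => x N i ω) : ℝ) ∂(P N) := by
      clear hNε hup
      obtain ⟨M, rfl⟩ : ∃ M, N = M + 1 := ⟨N - 1, by omega⟩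
      have h := le_integral_pairCount (hlaw (M + 1)) (hx (M + 1)) (ht0 (M + 1)) hN2
      push_cast
      rw [add_sub_cancel_right]
      exact h
    have hv : 0 ≤ (N : ℝ) ^ 3 * t N ^ 4 / 128 := by positivity
    rw [Pi.sub_apply, Real.norm_of_nonpos (by linarith), Real.norm_of_nonneg hv]
    nlinarith
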